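/- Let $\mathcal H_1,\mathcal H_2,\mathcal H_3$ be separable complex Hilbert spaces, let $\mathcal H=\mathcal H_1\otimes\mathcal H_2\otimes\mathcal H_3$ be their Hilbert space tensor product, and let $\mathrm{Tr}_j$ denote the partial trace that traces out the factor $\mathcal H_j$; for example, for a positive bounded operator $T$ on $\mathcal H$ and an orthonormal basis $(e_i)$ of $\mathcal H_1$, $\mathrm{Tr}_1T$ is the bounded operator on $\mathcal H_2\otimes\mathcal H_3$ with $\langle x,(\mathrm{Tr}_1T)y\rangle=\sum_i\langle e_i\otimes x,\,T(e_i\otimes y)\rangle$ for all $x,y$, if such an operator exists. For a positive bounded operator $A$ on $\mathcal H$ and real $p,q>0$ consider the two quantities $$ L_{p,q}(A)=\mathrm{Tr}_3\Big(\mathrm{Tr}_2\big[(\mathrm{Tr}_1A^q)^{p/q}\big]\Big)^{q/p},\qquad R_{p,q}(A)=\mathrm{Tr}_3\Big(\mathrm{Tr}_1\big[(\mathrm{Tr}_2A^p)^{q/p}\big]\Big) $$ in $[0,\infty]$, where each of them is $+\infty$ by convention if one of the partial traces inside it does not exist as a bounded operator (in finite dimensions both are always finite). Then, for every positive bounded operator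 $A$ on $\mathcal H$: 1. if $1\le q\le p\le 2$, then $L_{p,q}(A)\le R_{p,q}(A)$; 2. if $0<p\le 1$ and $q\ge p$, then $R_{p,q}(A)\le L_{p,q}(A)$. -/

import Mathlib

open scoped TensorProduct ENNReal InnerProductSpace

noncomputable section

namespace TraceMinkowski

/-- The Hilbert space tensor product: the completion of the algebraic tensor product with respect
to the inner product `⟪a ⊗ b, c ⊗ d⟫ = ⟪a, c⟫ * ⟪b, d⟫`. -/
def HTensor (E F : Type*) [NormedAddCommGroup E] [InnerProductSpace ℂ E]
    [NormedAddCommGroup F] [InnerProductSpace ℂ F] :=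
  UniformSpace.Completion (E ⊗[ℂ] F)

instance (E F : Type*) [NormedAddCommGroup E] [InnerProductSpace ℂ E]
    [NormedAddCommGroup F] [InnerProductSpace ℂ F] : NormedAddCommGroup (HTensor E F) :=
  inferInstanceAs (NormedAddCommGroup (UniformSpace.Completion (E ⊗[ℂ] F)))

instance (E F : Type*) [NormedAddCommGroup E] [InnerProductSpace ℂ E]
    [NormedAddCommGroup F] [InnerProductSpace ℂ F] : InnerProductSpace ℂ (HTensor E F) :=
  inferInstanceAs (InnerProductSpace ℂ (UniformSpace.Completion (E ⊗[ℂ] F)))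

instance (E F : Type*) [NormedAddCommGroup E] [InnerProductSpace ℂ E]
    [NormedAddCommGroup F] [InnerProductSpace ℂ F] : CompleteSpace (HTensor E F) :=
  inferInstanceAs (CompleteSpace (UniformSpace.Completion (E ⊗[ℂ] F)))

/-- The elementary tensor `x ⊗ y` as an element of the Hilbert space tensor product. -/
def htmul {E F : Type*} [NormedAddCommGroup E] [InnerProductSpace ℂ E]
    [NormedAddCommGroup F] [InnerProductSpace ℂ F] (x : E) (y : F) : HTensor E F :=
  ((x ⊗ₜ[ℂ] y : E ⊗[ℂ] F) : UniformSpace.Completion (E ⊗[ℂ] F))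

/-- The index set of a (chosen) orthonormal Hilbert basis of `E`. -/
def basisIndex (E : Type*) [NormedAddCommGroup E] [InnerProductSpace ℂ E] [CompleteSpace E] :
    Set E :=
  (exists_hilbertBasis ℂ E).choose

/-- A (chosen) orthonormal Hilbert basis of `E`. The traces of positive operators below do not
depend on the choice. -/
def onb (E : Type*) [NormedAddCommGroup E] [InnerProductSpace ℂ E] [CompleteSpace E] :
    HilbertBasis (basisIndex E) ℂ E :=
  (exists_hilbertBasis ℂ E).choose_spec.choose

/-- The trace `∑ᵢ ⟪eᵢ, T eᵢ⟫ ∈ [0, ∞]` of a positive bounded operator `T`. -/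
def trace {E : Type*} [NormedAddCommGroup E] [InnerProductSpace ℂ E] [CompleteSpace E]
    (T : E →L[ℂ] E) : ℝ≥0∞ :=
  ∑' i, ENNReal.ofReal (RCLike.re ⟪onb E i, T (onb E i)⟫_ℂ)

/-- The bounded operator `S` on `F` is the partial trace of the bounded operator `T` on `E ⊗ F`
over the first factor: `⟪x, S y⟫ = ∑ᵢ ⟪eᵢ ⊗ x, T (eᵢ ⊗ y)⟫`. -/
def IsTraceFst {E F : Type*} [NormedAddCommGroup E] [InnerProductSpace ℂ E] [CompleteSpace E]
    [NormedAddCommGroup F] [InnerProductSpace ℂ F]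
    (T : HTensor E F →L[ℂ] HTensor E F) (S : F →L[ℂ] F) : Prop :=
  ∀ x y : F, HasSum (fun i => ⟪htmul (onb E i) x, T (htmul (onb E i) y)⟫_ℂ) ⟪x, S y⟫_ℂ

/-- The bounded operator `S` on `E ⊗ G` is the partial trace of the bounded operator `T` on
`E ⊗ F ⊗ G` over the middle factor:
`⟪x ⊗ z, S (x' ⊗ z')⟫ = ∑ᵢ ⟪x ⊗ eᵢ ⊗ z, T (x' ⊗ eᵢ ⊗ z')⟫`. -/
def IsTraceMid {E F G : Type*} [NormedAddCommGroup E] [InnerProductSpace ℂ E]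
    [NormedAddCommGroup F] [InnerProductSpace ℂ F] [CompleteSpace F]
    [NormedAddCommGroup G] [InnerProductSpace ℂ G]
    (T : HTensor E (HTensor F G) →L[ℂ] HTensor E (HTensor F G))
    (S : HTensor E G →L[ℂ] HTensor E G) : Prop :=
  ∀ (x x' : E) (z z' : G),
    HasSum (fun i => ⟪htmul x (htmul (onb F i) z), T (htmul x' (htmul (onb F i) z'))⟫_ℂ)
      ⟪htmul x z, S (htmul x' z')⟫_ℂ

variable {H₁ H₂ H₃ : Type*}
  [NormedAddCommGroup H₁] [InnerProductSpace ℂ H₁] [CompleteSpace H₁]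
  [NormedAddCommGroup H₂] [InnerProductSpace ℂ H₂] [CompleteSpace H₂]
  [NormedAddCommGroup H₃] [InnerProductSpace ℂ H₃] [CompleteSpace H₃]

/-- `Tr₃ (Tr₂ [(Tr₁ A^q)^(p/q)])^(q/p) ∈ [0, ∞]`. Here `X = Tr₁ A^q` and `Y = Tr₂ X^(p/q)`. These
operators are unique if they exist, so the infimum is over at most one pair `X`, `Y`; it is `∞` if
one of the two partial traces is not a bounded operator. -/
def leftSide (p q : ℝ) (A : HTensor H₁ (HTensor H₂ H₃) →L[ℂ] HTensor H₁ (HTensor H₂ H₃)) :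
    ℝ≥0∞ :=
  ⨅ (X : HTensor H₂ H₃ →L[ℂ] HTensor H₂ H₃) (_ : IsTraceFst (A ^ q) X)
    (Y : H₃ →L[ℂ] H₃) (_ : IsTraceFst (X ^ (p / q)) Y), trace (Y ^ (q / p))

/-- `Tr₃ (Tr₁ [(Tr₂ A^p)^(q/p)]) ∈ [0, ∞]`. Here `X = Tr₂ A^p` and `Y = Tr₁ X^(q/p)`. Again the
infimum is over at most one pair `X`, `Y`, and it is `∞` if one of the two partial traces is not a
bounded operator. -/
def rightSide (p q : ℝ) (A : HTensor H₁ (HTensor H₂ H₃) →L[ℂ] HTensor H₁ (HTensor H₂ H₃)) :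
    ℝ≥0∞ :=
  ⨅ (X : HTensor H₁ H₃ →L[ℂ] HTensor H₁ H₃) (_ : IsTraceMid (A ^ p) X)
    (Y : H₃ →L[ℂ] H₃) (_ : IsTraceFst (X ^ (q / p)) Y), trace Y

end TraceMinkowski

end

/-! Put `B = A ^ q` and `r = p / q`. The two sides become `Tr₃ (Tr₂ (Tr₁ B)^r)^(1/r)` and `Tr₃ Tr₁
(Tr₂ B^r)^(1/r)`, and the claim is left ≤ right for `1 ≤ r ≤ 2` and right ≤ left for `0 < r ≤ 1`.

By Young's inequality, `Tr Y^(1/r)` is the infimum (`r ≥ 1`) or the supremum (`r ≤ 1`) over `W > 0`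
of `(1/r) Tr Y W^(1-r) + (1 - 1/r) Tr W`. Take `W` on `H₁ ⊗ H₃` nearly optimal for the right side
and use `W' = Tr₁ W` for the left side. As `Tr W = Tr W'`, it remains to compare `Tr B^r W^(1-r)`
with its value after applying `Tr₁` to both `B` and `W`: it does not increase for `1 ≤ r ≤ 2`
(`sum_rpow_le_of_one_le`) and does not decrease for `0 < r ≤ 1` (`sum_rpow_le_of_le_one`). This is
the Lieb–Ando convexity and concavity, proved here directly.

For that proof, diagonalize `W` and `W'`. For an eigenvalue `ω` write `ω^(1-r) B^r = ω S^r` with `S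
= B/ω`; for `0 < r < 1` this is an integral over `t` of positive multiples of `ω S (t + S)⁻¹`, whose
quadratic form at `u` is the minimum over `x` of `ω ‖u - x‖² + t⁻¹ ⟪x, B x⟫`. A family of vectors
attached to the eigenvectors of `W'` lifts to one attached to those of `W`, and the lift preserves
both summed terms. Lifted minimizers are therefore admissible upstairs (`sum_resolv_le`). For `1 < r
< 2` an extra factor `B` reverses the sign, and `r = 2` is a completion of squares.

In infinite dimension the inequalities are proved for finite truncations in all three bases
(`sum_partialFst_rpow_le_add`, `sum_rpow_mul_qform_partialMid_le`). Finiteness of the larger side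
bounds the truncations uniformly, and real powers are strongly continuous on bounded sets
(`tendsto_rpow_apply`); the limits give both the existence of the partial traces on the smaller side
and the inequality (`exists_left_le`, `exists_right_le`). -/

open Filter Topology

set_option linter.unusedSectionVars false

noncomputable section

namespace TraceMinkowski

/-! ### Quadratic forms, real powers and strong limits of positive operators -/

section Operators

variable {H : Type*} [NormedAddCommGroup H] [InnerProductSpace ℂ H] [CompleteSpace H]

/-- The real quadratic form `re ⟪x, T x⟫` of a bounded operator. -/
def qform (T : H →L[ℂ] H) (x : H) : ℝ := RCLike.re ⟪x, T x⟫_ℂ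

lemma qform_add (S T : H →L[ℂ] H) (x : H) : qform (S + T) x = qform S x + qform T x := by
  simp [qform]

lemma qform_sub (S T : H →L[ℂ] H) (x : H) : qform (S - T) x = qform S x - qform T x := by
  simp [qform]

lemma qform_smul (c : ℝ) (T : H →L[ℂ] H) (x : H) : qform (c • T) x = c * qform T x := by
  simp [qform, inner_smul_right_eq_smul]

lemma qform_one (x : H) : qform (1 : H →L[ℂ] H) x = ‖x‖ ^ 2 := by
  simp [qform, inner_self_eq_norm_sq_to_K, ← Complex.ofReal_pow]

lemma qform_sum {ι : Type*} (s : Finset ι) (T : ι → H →L[ℂ] H) (x : H) :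
    qform (∑ i ∈ s, T i) x = ∑ i ∈ s, qform (T i) x := by
  simp [qform]

lemma qform_smul_vec (T : H →L[ℂ] H) (c : ℝ) (x : H) : qform T (c • x) = c ^ 2 * qform T x := by
  have : ((c • x : H)) = (c : ℂ) • x := by simp
  rw [this]
  simp only [qform, map_smul, inner_smul_left, inner_smul_right, Complex.conj_ofReal]
  rw [← mul_assoc, ← Complex.ofReal_mul]
  simp [sq]

lemma qform_nonneg {T : H →L[ℂ] H} (hT : 0 ≤ T) (x : H) : 0 ≤ qform T x :=
  ((ContinuousLinearMap.nonneg_iff_isPositive T).1 hT).re_inner_nonneg_right x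

lemma qform_mono {S T : H →L[ℂ] H} (h : S ≤ T) (x : H) : qform S x ≤ qform T x := by
  have h' : 0 ≤ T - S := sub_nonneg.2 h
  have := qform_nonneg h' x
  rw [qform_sub] at this
  linarith

lemma inner_symm_of_nonneg {T : H →L[ℂ] H} (hT : 0 ≤ T) (x y : H) : ⟪T x, y⟫_ℂ = ⟪x, T y⟫_ℂ :=
  ((ContinuousLinearMap.nonneg_iff_isPositive T).1 hT).inner_left_eq_inner_right x y

lemma inner_eq_qform {T : H →L[ℂ] H} (hT : 0 ≤ T) (x : H) : ⟪x, T x⟫_ℂ = (qform T x : ℂ) := by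
  have h : (starRingEnd ℂ) ⟪x, T x⟫_ℂ = ⟪x, T x⟫_ℂ := by
    rw [inner_conj_symm, inner_symm_of_nonneg hT]
  exact (Complex.conj_eq_iff_re.1 h).symm

lemma nonneg_of_qform {T : H →L[ℂ] H} (hT : IsSelfAdjoint T) (h : ∀ x, 0 ≤ qform T x) :
    0 ≤ T := by
  rw [ContinuousLinearMap.nonneg_iff_isPositive, ContinuousLinearMap.isPositive_def']
  refine ⟨hT, fun x => ?_⟩
  rw [ContinuousLinearMap.reApplyInnerSelf_apply, inner_re_symm]
  exact h x

lemma adjoint_comp_nonneg {K : Type*} [NormedAddCommGroup K] [InnerProductSpace ℂ K]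
    [CompleteSpace K] (V : H →L[ℂ] K) {T : K →L[ℂ] K} (hT : 0 ≤ T) :
    0 ≤ V.adjoint ∘L T ∘L V := by
  rw [ContinuousLinearMap.nonneg_iff_isPositive] at *
  exact hT.adjoint_conj V

lemma le_of_qform {S T : H →L[ℂ] H} (hS : IsSelfAdjoint S) (hT : IsSelfAdjoint T)
    (h : ∀ x, qform S x ≤ qform T x) : S ≤ T := by
  rw [← sub_nonneg]
  refine nonneg_of_qform (hT.sub hS) fun x => ?_
  have := h x
  have e := qform_sub T S x
  linarith

lemma rpow_eq_cfc (T : H →L[ℂ] H) (hT : 0 ≤ T) (s : ℝ) :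
    T ^ s = cfc (fun x : ℝ => x ^ s) T := CFC.rpow_eq_cfc_real (ha := hT)

lemma spectrum_mem_Icc {T : H →L[ℂ] H} (hT : 0 ≤ T) {C : ℝ} (hC : ‖T‖ ≤ C) {x : ℝ}
    (hx : x ∈ spectrum ℝ T) : x ∈ Set.Icc 0 C := by
  refine ⟨spectrum_nonneg_of_nonneg hT hx, ?_⟩
  have h1 : ‖cfc (id : ℝ → ℝ) T‖ ≤ C := by rw [cfc_id ℝ T]; exact hC
  exact (le_abs_self x).trans ((norm_apply_le_norm_cfc (id : ℝ → ℝ) T hx).trans h1)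

/-- Real powers of positive operators are approximated, uniformly on bounded sets, by polynomials. -/
lemma exists_polynomial_rpow {s : ℝ} (hs : 0 ≤ s) (C : ℝ) {ε : ℝ} (hε : 0 < ε) :
    ∃ p : Polynomial ℝ, (∀ x ∈ Set.Icc 0 C, |x ^ s - p.eval x| ≤ ε) ∧
      ∀ T : H →L[ℂ] H, 0 ≤ T → ‖T‖ ≤ C → ‖T ^ s - Polynomial.aeval T p‖ ≤ ε := by
  obtain ⟨p, hp⟩ := exists_polynomial_near_of_continuousOn 0 C (fun x => x ^ s)
    (Real.continuous_rpow_const hs).continuousOn ε hε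
  refine ⟨p, fun x hx => ?_, fun T hT hC => ?_⟩
  · rw [abs_sub_comm]; exact (hp x hx).le
  · have hc : ContinuousOn (fun x : ℝ => x ^ s) (spectrum ℝ T) :=
      (Real.continuous_rpow_const hs).continuousOn
    rw [rpow_eq_cfc T hT, ← cfc_polynomial p T, ← cfc_sub _ _ T]
    refine norm_cfc_le hε.le fun x hx => ?_
    rw [Real.norm_eq_abs, abs_sub_comm]
    exact (hp x (spectrum_mem_Icc hT hC hx)).le

/-- The uniform norm bound lets the argument move together with the operator, which makes products
of strongly convergent bounded families converge. -/
lemma tendsto_clm_apply {ι : Type*} {l : Filter ι} {T : ι → H →L[ℂ] H} {S : H →L[ℂ] H} {C : ℝ}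
    (hC : ∀ i, ‖T i‖ ≤ C) (h : ∀ x, Tendsto (fun i => T i x) l (𝓝 (S x)))
    {v : ι → H} {y : H} (hv : Tendsto v l (𝓝 y)) :
    Tendsto (fun i => T i (v i)) l (𝓝 (S y)) := by
  have h1 : Tendsto (fun i => T i (v i - y)) l (𝓝 0) := by
    have h2 : Tendsto (fun i => C * ‖v i - y‖) l (𝓝 0) := by
      have : Tendsto (fun i => ‖v i - y‖) l (𝓝 0) := by
        simpa using (hv.sub_const y).norm
      simpa using this.const_mul C
    refine squeeze_zero_norm (fun i => ?_) h2
    exact (T i).le_of_opNorm_le (hC i) _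
  have := h1.add (h y)
  simpa using this

lemma tendsto_aeval_apply {ι : Type*} {l : Filter ι} {T : ι → H →L[ℂ] H} {S : H →L[ℂ] H} {C : ℝ}
    (hC : ∀ i, ‖T i‖ ≤ C) (h : ∀ x, Tendsto (fun i => T i x) l (𝓝 (S x)))
    (p : Polynomial ℝ) (x : H) :
    Tendsto (fun i => (Polynomial.aeval (T i) p) x) l (𝓝 ((Polynomial.aeval S p) x)) := by
  have hpow : ∀ n : ℕ, ∀ x, Tendsto (fun i => ((T i) ^ n) x) l (𝓝 ((S ^ n) x)) := by
    intro n
    induction n with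
    | zero => intro x; simpa using tendsto_const_nhds
    | succ n ih =>
      intro x
      simp only [pow_succ', mul_apply_eq_comp]
      exact tendsto_clm_apply hC h (ih x)
  induction p using Polynomial.induction_on' with
  | add p q hp hq => simpa using hp.add hq
  | monomial n a =>
    simpa [Polynomial.aeval_monomial, Algebra.algebraMap_eq_smul_one] using (hpow n x).const_smul a

/-- Real powers are strongly continuous on bounded sets of positive operators. -/
lemma tendsto_rpow_apply {ι : Type*} {l : Filter ι} {T : ι → H →L[ℂ] H} {S : H →L[ℂ] H} {C : ℝ}
    (hT : ∀ i, 0 ≤ T i) (hS : 0 ≤ S) (hC : ∀ i, ‖T i‖ ≤ C)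
    (h : ∀ x, Tendsto (fun i => T i x) l (𝓝 (S x))) {s : ℝ} (hs : 0 ≤ s) (x : H) :
    Tendsto (fun i => (T i ^ s) x) l (𝓝 ((S ^ s) x)) := by
  rw [Metric.tendsto_nhds]
  intro ε hε
  have hδ : 0 < ε / (3 * (‖x‖ + 1)) := by positivity
  obtain ⟨p, -, hp⟩ := exists_polynomial_rpow (H := H) hs (max C ‖S‖) hδ
  have h1 := Metric.tendsto_nhds.1 (tendsto_aeval_apply hC h p x) (ε / 3) (by positivity)
  have key : ∀ R : H →L[ℂ] H, 0 ≤ R → ‖R‖ ≤ max C ‖S‖ →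
      dist ((R ^ s) x) ((Polynomial.aeval R p) x) < ε / 3 := by
    intro R hR hRC
    rw [dist_eq_norm, ← sub_apply]
    calc _ ≤ ε / (3 * (‖x‖ + 1)) * ‖x‖ := ContinuousLinearMap.le_of_opNorm_le _ (hp R hR hRC) _
      _ < ε / (3 * (‖x‖ + 1)) * (‖x‖ + 1) := by gcongr; linarith
      _ = ε / 3 := by field_simp
  filter_upwards [h1] with i hi
  have ha := key (T i) (hT i) ((hC i).trans (le_max_left _ _))
  have hb := key S hS (le_max_right _ _)
  rw [dist_comm] at hb
  calc _ ≤ _ := dist_triangle4 _ ((Polynomial.aeval (T i) p) x) ((Polynomial.aeval S p) x) _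
    _ < ε := by linarith

/-- Immediate for polynomials; a polynomial close to the power on an interval containing both `c`
and the spectrum transfers it. -/
lemma rpow_apply_of_eigen {T : H →L[ℂ] H} (hT : 0 ≤ T) {x : H} {c : ℝ} (hc : 0 ≤ c)
    (h : T x = c • x) {s : ℝ} (hs : 0 ≤ s) : (T ^ s) x = c ^ s • x := by
  rw [← sub_eq_zero, ← norm_le_zero_iff]
  refine le_of_forall_pos_le_add fun ε hε => ?_
  have hδ : 0 < ε / (2 * (‖x‖ + 1)) := by positivity
  obtain ⟨p, hp, hp'⟩ := exists_polynomial_rpow (H := H) hs (max c ‖T‖) hδ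
  have h1 := hp' T hT (le_max_right _ _)
  have h2 := hp c ⟨hc, le_max_left _ _⟩
  have hpow : ∀ n : ℕ, (T ^ n) x = c ^ n • x := by
    intro n
    induction n with
    | zero => simp
    | succ n ih =>
      rw [pow_succ', mul_apply_eq_comp, ih]
      have : T (c ^ n • x) = c ^ n • T x := by
        exact ((T.restrictScalars ℝ).map_smul (c ^ n) x)
      rw [this, h, smul_smul, ← pow_succ]
  have h3 : (Polynomial.aeval T p) x = p.eval c • x := by
    clear hp hp' h1 h2
    induction p using Polynomial.induction_on' with
    | add p q hp hq => simp [hp, hq, add_smul]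
    | monomial n a =>
      simp [Polynomial.aeval_monomial, Algebra.algebraMap_eq_smul_one, hpow, smul_smul]
  have e : (T ^ s) x - c ^ s • x = (T ^ s - Polynomial.aeval T p) x - (c ^ s - p.eval c) • x := by
    rw [sub_apply, h3, sub_smul]; abel
  rw [e, zero_add]
  calc _ ≤ ‖(T ^ s - Polynomial.aeval T p) x‖ + ‖(c ^ s - p.eval c) • x‖ := norm_sub_le _ _
    _ ≤ ε / (2 * (‖x‖ + 1)) * ‖x‖ + ε / (2 * (‖x‖ + 1)) * ‖x‖ := by
        gcongr
        · exact ContinuousLinearMap.le_of_opNorm_le _ h1 _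
        · rw [norm_smul]; gcongr; exact h2
    _ ≤ ε / (2 * (‖x‖ + 1)) * (‖x‖ + 1) + ε / (2 * (‖x‖ + 1)) * (‖x‖ + 1) := by
        gcongr <;> linarith
    _ = ε := by field_simp; ring

/-- Bernoulli's inequality at `x / c - 1`: the tangent at `c` lies below a convex power. -/
lemma rpow_tangent_le {s c x : ℝ} (hs : 1 ≤ s) (hc : 0 < c) (hx : 0 ≤ x) :
    c ^ s + s * c ^ (s - 1) * (x - c) ≤ x ^ s := by
  have h := one_add_mul_self_le_rpow_one_add (s := x / c - 1) (by
    have : 0 ≤ x / c := by positivity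
    linarith) hs
  have h2 : (1 + (x / c - 1)) ^ s = x ^ s / c ^ s := by
    rw [add_sub_cancel, Real.div_rpow hx hc.le]
  have h3 : c ^ s = c ^ (s - 1) * c := by
    rw [Real.rpow_sub_one hc.ne']; field_simp
  have hcs : 0 < c ^ s := Real.rpow_pos_of_pos hc s
  rw [h2, le_div_iff₀ hcs] at h
  refine le_trans (le_of_eq ?_) h
  rw [h3]
  field_simp

lemma affine_le_rpow {T : H →L[ℂ] H} (hT : 0 ≤ T) {a b s : ℝ} (hs : 0 ≤ s)
    (h : ∀ y : ℝ, 0 ≤ y → a + b * y ≤ y ^ s) : a • (1 : H →L[ℂ] H) + b • T ≤ T ^ s := by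
  have hcont : ContinuousOn (fun x : ℝ => x ^ s) (spectrum ℝ T) :=
    (Real.continuous_rpow_const hs).continuousOn
  have hcont' : ContinuousOn (fun x : ℝ => b * x) (spectrum ℝ T) := by fun_prop
  have hcont'' : ContinuousOn (fun x : ℝ => a + b * x) (spectrum ℝ T) := by fun_prop
  have e : a • (1 : H →L[ℂ] H) + b • T = cfc (fun y : ℝ => a + b * y) T := by
    rw [cfc_const_add a (fun x => b * x) T hcont', cfc_const_mul_id b T,
      Algebra.algebraMap_eq_smul_one]
  rw [e, rpow_eq_cfc T hT]
  exact cfc_mono (fun y hy => h y (spectrum_nonneg_of_nonneg hT hy)) hcont'' hcont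

/-- Jensen's inequality for powers `s ≥ 1` in the state of a unit vector. -/
lemma qform_rpow_ge {T : H →L[ℂ] H} (hT : 0 ≤ T) {x : H} (hx : ‖x‖ = 1) {s : ℝ} (hs : 1 ≤ s) :
    qform T x ^ s ≤ qform (T ^ s) x := by
  rcases (qform_nonneg hT x).eq_or_lt with h0 | h0
  · rw [← h0, Real.zero_rpow (by linarith)]
    exact qform_nonneg CFC.rpow_nonneg x
  · set c := qform T x with hc
    have h1 := affine_le_rpow hT (a := c ^ s - s * c ^ (s - 1) * c) (b := s * c ^ (s - 1)) (s := s)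
      (by linarith) fun y hy => by have := rpow_tangent_le hs h0 hy; linarith
    have h2 := qform_mono h1 x
    rw [qform_add, qform_smul, qform_smul, qform_one, hx, ← hc] at h2
    linarith

/-- Jensen's inequality for powers `0 < s ≤ 1` in the state of a unit vector. -/
lemma qform_rpow_le {T : H →L[ℂ] H} (hT : 0 ≤ T) {x : H} (hx : ‖x‖ = 1) {s : ℝ} (hs : 0 < s)
    (hs1 : s ≤ 1) : qform (T ^ s) x ≤ qform T x ^ s := by
  -- The concave case is the convex one for `T ^ s` and the exponent `s⁻¹`.
  have h := qform_rpow_ge (T := T ^ s) CFC.rpow_nonneg hx (s := s⁻¹) (one_le_inv₀ hs |>.2 hs1)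
  rw [CFC.rpow_rpow_of_exponent_nonneg _ _ _ hs.le (inv_nonneg.2 hs.le) hT,
    mul_inv_cancel₀ hs.ne', CFC.rpow_one T hT] at h
  have h0 := qform_nonneg (CFC.rpow_nonneg (a := T) (y := s)) x
  have := Real.rpow_le_rpow (by positivity) h hs.le
  rwa [← Real.rpow_mul h0, inv_mul_cancel₀ hs.ne', Real.rpow_one] at this

lemma qform_eq_norm_sqrt {T : H →L[ℂ] H} (hT : 0 ≤ T) (x : H) :
    qform T x = ‖CFC.sqrt T x‖ ^ 2 := by
  have h : T x = CFC.sqrt T (CFC.sqrt T x) := by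
    rw [← mul_apply_eq_comp, CFC.sqrt_mul_sqrt_self T hT]
  rw [qform, h, ← inner_symm_of_nonneg (CFC.sqrt_nonneg T), inner_self_eq_norm_sq_to_K]
  simp [← Complex.ofReal_pow]

/-- Since `T = √T √T`, `‖T x‖²` is the form of `T` at `√T x`, and `‖√T x‖²` is the form at `x`. -/
lemma norm_apply_sq_le {T : H →L[ℂ] H} (hT : 0 ≤ T) {C : ℝ}
    (hC : ∀ x, qform T x ≤ C * ‖x‖ ^ 2) (x : H) : ‖T x‖ ^ 2 ≤ C * qform T x := by
  have h : T x = CFC.sqrt T (CFC.sqrt T x) := by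
    rw [← mul_apply_eq_comp, CFC.sqrt_mul_sqrt_self T hT]
  rw [h, ← qform_eq_norm_sqrt hT, qform_eq_norm_sqrt hT x]
  exact hC _

lemma norm_le_of_qform {T : H →L[ℂ] H} (hT : 0 ≤ T) {C : ℝ} (hC0 : 0 ≤ C)
    (hC : ∀ x, qform T x ≤ C * ‖x‖ ^ 2) : ‖T‖ ≤ C := by
  refine T.opNorm_le_bound hC0 fun x => ?_
  have h := (norm_apply_sq_le hT hC x).trans (mul_le_mul_of_nonneg_left (hC x) hC0)
  have : ‖T x‖ ^ 2 ≤ (C * ‖x‖) ^ 2 := by rw [mul_pow, sq C]; linarith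
  exact le_of_sq_le_sq this (by positivity)

/-- A family of positive operators with uniformly bounded finite partial sums has a strongly
convergent sum. -/
lemma exists_hasSum_apply {ι : Type*} {T : ι → H →L[ℂ] H} (hT : ∀ i, 0 ≤ T i) {C : ℝ}
    (hC0 : 0 ≤ C) (hC : ∀ s : Finset ι, ∀ x, qform (∑ i ∈ s, T i) x ≤ C * ‖x‖ ^ 2) :
    ∃ S : H →L[ℂ] H, 0 ≤ S ∧ ∀ x, HasSum (fun i => T i x) (S x) := by
  have hTs : ∀ s : Finset ι, 0 ≤ ∑ i ∈ s, T i := fun s => Finset.sum_nonneg fun i _ => hT i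
  have hsum : ∀ x, Summable fun i => T i x := by
    intro x
    have h1 : Summable fun i => qform (T i) x :=
      summable_of_sum_le (fun i => qform_nonneg (hT i) x) (c := C * ‖x‖ ^ 2)
        (fun s => by rw [← qform_sum]; exact hC s x)
    rw [summable_iff_vanishing_norm] at h1 ⊢
    intro ε hε
    -- With this threshold a tail has norm squared at most `C ε² / (C + 1) < ε²`, by
    -- `norm_apply_sq_le`.
    obtain ⟨s, hs⟩ := h1 (ε ^ 2 / (C + 1)) (by positivity)
    refine ⟨s, fun t ht => ?_⟩
    have h2 := hs t ht
    rw [← qform_sum, Real.norm_eq_abs, abs_of_nonneg (qform_nonneg (hTs t) x),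
      lt_div_iff₀ (by positivity)] at h2
    have h3 := norm_apply_sq_le (hTs t) (hC t) x
    have h4 := qform_nonneg (hTs t) x
    rw [sum_apply] at h3
    exact lt_of_pow_lt_pow_left₀ 2 hε.le (by nlinarith)
  let S₀ : H →ₗ[ℂ] H :=
    { toFun := fun x => ∑' i, T i x
      map_add' := fun x y => by
        simp only [map_add]; exact (hsum x).tsum_add (hsum y)
      map_smul' := fun c x => by
        simp only [map_smul, RingHom.id_apply]; exact (hsum x).tsum_const_smul c }
  let S : H →L[ℂ] H := S₀.mkContinuous C fun x => by
    have h1 : Tendsto (fun s : Finset ι => ‖∑ i ∈ s, T i x‖) atTop (𝓝 ‖S₀ x‖) :=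
      (hsum x).hasSum.norm
    refine le_of_tendsto' h1 fun s => ?_
    rw [← sum_apply]
    exact ContinuousLinearMap.le_of_opNorm_le _ (norm_le_of_qform (hTs s) hC0 (hC s)) x
  have hS : ∀ x, HasSum (fun i => T i x) (S x) := fun x => (hsum x).hasSum
  refine ⟨S, ?_, hS⟩
  rw [ContinuousLinearMap.nonneg_iff_isPositive]
  refine ⟨fun x y => ?_, fun x => ?_⟩
  · have h1 := (hS x).mapL ((innerSL ℂ y))
    have h2 := (hS y).mapL ((innerSL ℂ x))
    have h3 := h1.map (starRingEnd ℂ) RCLike.continuous_conj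
    simp only [innerSL_apply_apply, Function.comp_def, inner_conj_symm] at h2 h3
    simp only [inner_symm_of_nonneg (hT _)] at h3
    exact h3.unique h2
  · have h2 := ((hS x).mapL (innerSL ℂ x)).mapL Complex.reCLM
    rw [ContinuousLinearMap.reApplyInnerSelf_apply, inner_re_symm]
    refine h2.nonneg fun i => ?_
    exact qform_nonneg (hT i) x

lemma hasSum_norm_sq_inner {ι : Type*} (b : HilbertBasis ι ℂ H) (x : H) :
    HasSum (fun i => ‖⟪b i, x⟫_ℂ‖ ^ 2) (‖x‖ ^ 2) := by
  have h := (b.hasSum_inner_mul_inner x x).mapL Complex.reCLM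
  have e : ∀ i, Complex.reCLM (⟪x, b i⟫_ℂ * ⟪b i, x⟫_ℂ) = ‖⟪b i, x⟫_ℂ‖ ^ 2 := by
    intro i
    rw [← inner_conj_symm x, Complex.reCLM_apply, ← Complex.normSq_eq_conj_mul_self,
      Complex.normSq_eq_norm_sq, Complex.ofReal_re]
  simp only [e] at h
  convert h using 1
  rw [inner_self_eq_norm_sq_to_K]
  simp [← Complex.ofReal_pow]

/-- The sum of a positive quadratic form over an orthonormal family is at most its trace. -/
lemma sum_qform_le_tsum {ι κ : Type*} {T : H →L[ℂ] H} (hT : 0 ≤ T) {u : κ → H}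
    (hu : Orthonormal ℂ u) (s : Finset κ) (b : HilbertBasis ι ℂ H) :
    ENNReal.ofReal (∑ i ∈ s, qform T (u i)) ≤ ∑' l, ENNReal.ofReal (qform T (b l)) := by
  rw [ENNReal.ofReal_sum_of_nonneg fun i _ => qform_nonneg hT _]
  -- Parseval for `√T (u i)` in the basis `b`; after exchanging the sums, Bessel's inequality for
  -- `u` bounds the `l`-th term by `‖√T (b l)‖²`.
  have h1 : ∀ i, ENNReal.ofReal (qform T (u i)) =
      ∑' l, ENNReal.ofReal (‖⟪u i, CFC.sqrt T (b l)⟫_ℂ‖ ^ 2) := by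
    intro i
    rw [qform_eq_norm_sqrt hT, ← (hasSum_norm_sq_inner b _).tsum_eq,
      ENNReal.ofReal_tsum_of_nonneg (fun _ => by positivity) (hasSum_norm_sq_inner b _).summable]
    refine tsum_congr fun l => ?_
    rw [← inner_symm_of_nonneg (CFC.sqrt_nonneg T), norm_inner_symm]
  simp only [h1]
  rw [← Summable.tsum_finsetSum fun _ _ => ENNReal.summable]
  refine ENNReal.tsum_le_tsum fun l => ?_
  rw [← ENNReal.ofReal_sum_of_nonneg fun i _ => by positivity, qform_eq_norm_sqrt hT]
  exact ENNReal.ofReal_le_ofReal (hu.sum_inner_products_le _)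

lemma qform_le_of_tsum_le {ι : Type*} {T : H →L[ℂ] H} (hT : 0 ≤ T) (b : HilbertBasis ι ℂ H)
    {C : ℝ} (hC0 : 0 ≤ C) (h : ∑' l, ENNReal.ofReal (qform T (b l)) ≤ ENNReal.ofReal C) {x : H}
    (hx : ‖x‖ = 1) : qform T x ≤ C := by
  have hu : Orthonormal ℂ (fun _ : Unit => x) := ⟨fun _ => hx, fun i j hij => (hij rfl).elim⟩
  have h1 := (sum_qform_le_tsum hT hu Finset.univ b).trans h
  rw [ENNReal.ofReal_le_ofReal_iff hC0] at h1
  simpa using h1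

lemma qform_le_of_unit {T : H →L[ℂ] H} {C : ℝ} (h : ∀ x : H, ‖x‖ = 1 → qform T x ≤ C) (x : H) :
    qform T x ≤ C * ‖x‖ ^ 2 := by
  rcases eq_or_ne x 0 with rfl | hx
  · simp [qform]
  · have hx' : ‖x‖ ≠ 0 := norm_ne_zero_iff.2 hx
    have h1 := h (‖x‖⁻¹ • x) (by rw [norm_smul, norm_inv, norm_norm, inv_mul_cancel₀ hx'])
    rw [qform_smul_vec, inv_pow, inv_mul_le_iff₀ (by positivity)] at h1
    linarith

end Operators

/-! ### Resolvents, their variational formula, and integral representation of powers -/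

section Resolvent

open MeasureTheory Set Real

variable {H : Type*} [NormedAddCommGroup H] [InnerProductSpace ℂ H] [CompleteSpace H]

/-- The real part of the inner product. -/
def rip (x y : H) : ℝ := RCLike.re ⟪x, y⟫_ℂ

lemma rip_comm (x y : H) : rip x y = rip y x := inner_re_symm ..

lemma rip_sub_left (x y z : H) : rip (x - y) z = rip x z - rip y z := by
  simp [rip]

lemma rip_sub_right (x y z : H) : rip x (y - z) = rip x y - rip x z := by
  simp [rip]

lemma rip_smul_right (c : ℝ) (x y : H) : rip x (c • y) = c * rip x y := by
  simp [rip, inner_smul_right_eq_smul]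

lemma rip_smul_left (c : ℝ) (x y : H) : rip (c • x) y = c * rip x y := by
  rw [rip_comm, rip_smul_right, rip_comm]

lemma rip_self (x : H) : rip x x = ‖x‖ ^ 2 := by
  rw [← qform_one x]; rfl

lemma qform_eq_rip (T : H →L[ℂ] H) (x : H) : qform T x = rip x (T x) := rfl

lemma rip_symm_of_nonneg {T : H →L[ℂ] H} (hT : 0 ≤ T) (x y : H) : rip (T x) y = rip x (T y) := by
  rw [rip, inner_symm_of_nonneg hT, rip]

lemma map_real_smul (T : H →L[ℂ] H) (c : ℝ) (x : H) : T (c • x) = c • T x :=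
  (T.restrictScalars ℝ).map_smul c x

/-- The resolvent `(t + S)⁻¹` of a positive operator `S` at `-t < 0`. -/
def resolv (S : H →L[ℂ] H) (t : ℝ) : H →L[ℂ] H := cfc (fun x : ℝ => (t + x)⁻¹) S

lemma continuousOn_resolv {S : H →L[ℂ] H} (hS : 0 ≤ S) {t : ℝ} (ht : 0 < t) :
    ContinuousOn (fun x : ℝ => (t + x)⁻¹) (spectrum ℝ S) := by
  refine ContinuousOn.inv₀ (by fun_prop) fun x hx => ?_
  have := spectrum_nonneg_of_nonneg hS hx
  positivity

lemma mul_resolv {S : H →L[ℂ] H} (hS : 0 ≤ S) {t : ℝ} (ht : 0 < t) :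
    S * resolv S t = 1 - t • resolv S t := by
  have hc := continuousOn_resolv hS ht
  have h1 : (t • (1 : H →L[ℂ] H) + S) * resolv S t = 1 := by
    have e : t • (1 : H →L[ℂ] H) + S = cfc (fun x : ℝ => t + x) S := by
      rw [cfc_const_add t (fun x => x) S (by fun_prop), cfc_id' ℝ S,
        Algebra.algebraMap_eq_smul_one]
    rw [e, resolv, ← cfc_mul (fun x : ℝ => t + x) _ S (by fun_prop) hc]
    rw [← cfc_one ℝ S]
    refine cfc_congr fun x hx => ?_
    have := spectrum_nonneg_of_nonneg hS hx
    have h : t + x ≠ 0 := by positivity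
    simp [h]
  rw [add_mul, smul_one_mul] at h1
  rw [← h1]; abel

lemma apply_resolv {S : H →L[ℂ] H} (hS : 0 ≤ S) {t : ℝ} (ht : 0 < t) (u : H) :
    S (resolv S t u) = u - t • resolv S t u := by
  have := congrArg (fun T : H →L[ℂ] H => T u) (mul_resolv hS ht)
  simpa using this

lemma qform_one_sub_resolv (S : H →L[ℂ] H) (t : ℝ) (u : H) :
    qform (1 - t • resolv S t) u = ‖u‖ ^ 2 - t * rip u (resolv S t u) := by
  rw [qform_sub, qform_one, qform_smul, qform_eq_rip]

/-- Variational upper bound for the parallel sum of `1` and `t⁻¹ S`. -/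
lemma qform_resolv_le {S : H →L[ℂ] H} (hS : 0 ≤ S) {t : ℝ} (ht : 0 < t) (u x : H) :
    qform (1 - t • resolv S t) u ≤ ‖u - x‖ ^ 2 + t⁻¹ * qform S x := by
  have h1 := apply_resolv hS ht u
  rw [qform_one_sub_resolv]
  generalize resolv S t u = y at h1
  -- The gap between the two sides is `‖t y - x‖² + t⁻¹ ⟪t y - x, S (t y - x)⟫`; expanding it uses
  -- only `S y = u - t y`.
  have h2 := qform_nonneg hS (t • y - x)
  have h3 : 0 ≤ t * rip (t • y - x) (t • y - x) := by rw [rip_self]; positivity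
  simp only [qform_eq_rip, ← rip_self, map_sub, map_real_smul, h1, rip_sub_left, rip_sub_right,
    rip_smul_left, rip_smul_right] at h2 h3 ⊢
  have h4 : rip y (S x) = rip x u - t * rip x y := by
    rw [← rip_symm_of_nonneg hS, h1, rip_comm, rip_sub_right, rip_smul_right]
  rw [h4] at h2
  rw [rip_comm y x] at h3
  rw [rip_comm u x, rip_comm u y]
  have h5 : 0 ≤ t⁻¹ * (t * (t * rip y u) - 2 * t * rip x u + rip x (S x) + t * rip x x) :=
    mul_nonneg (by positivity) (by linarith)
  have h6 : t⁻¹ * (t * (t * rip y u) - 2 * t * rip x u + rip x (S x) + t * rip x x) =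
      t * rip y u - 2 * rip x u + t⁻¹ * rip x (S x) + rip x x := by
    field_simp
  linarith

/-- The variational bound `qform_resolv_le` is attained at `x = t (t + S)⁻¹ u`. -/
lemma qform_resolv_eq {S : H →L[ℂ] H} (hS : 0 ≤ S) {t : ℝ} (ht : 0 < t) (u : H) :
    qform (1 - t • resolv S t) u =
      ‖u - t • resolv S t u‖ ^ 2 + t⁻¹ * qform S (t • resolv S t u) := by
  have h1 := apply_resolv hS ht u
  rw [qform_one_sub_resolv]
  generalize resolv S t u = y at h1
  simp only [qform_eq_rip, ← rip_self, map_real_smul, h1, rip_sub_left, rip_sub_right,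
    rip_smul_left, rip_smul_right]
  rw [rip_comm y u]
  field_simp
  ring

lemma cfcₙ_rpowIntegrand_eq {S : H →L[ℂ] H} (hS : 0 ≤ S) {p t : ℝ} (hp : p ∈ Ioo 0 1)
    (ht : 0 < t) : cfcₙ (rpowIntegrand₀₁ p t) S = t ^ (p - 1) • (1 - t • resolv S t) := by
  have hc := continuousOn_resolv hS ht
  have hc' : ContinuousOn (rpowIntegrand₀₁ p t) (spectrum ℝ S) :=
    (continuousOn_rpowIntegrand₀₁_Ici hp ht).mono fun x hx => spectrum_nonneg_of_nonneg hS hx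
  have hc'' : ContinuousOn (rpowIntegrand₀₁ p t) (quasispectrum ℝ S) :=
    (continuousOn_rpowIntegrand₀₁_Ici hp ht).mono fun x hx => quasispectrum_nonneg_of_nonneg S hS x hx
  rw [cfcₙ_eq_cfc hc'' rpowIntegrand₀₁_zero_right]
  have e : t ^ (p - 1) • (1 - t • resolv S t) =
      cfc (fun x : ℝ => t ^ (p - 1) * (1 - t * (t + x)⁻¹)) S := by
    rw [cfc_const_mul _ _ S (by fun_prop), cfc_sub _ _ S (by fun_prop) (by fun_prop),
      cfc_const_one ℝ S, cfc_const_mul _ _ S hc]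
    rfl
  rw [e]
  refine cfc_congr fun x hx => ?_
  have := spectrum_nonneg_of_nonneg hS hx
  have h : t + x ≠ 0 := by positivity
  simp only [rpowIntegrand₀₁]
  rw [Real.rpow_sub_one ht.ne']
  field_simp

/-- A measure representing `x ↦ x ^ p` on `[0, ∞)` by resolvents. -/
def IsRepresenting (p : ℝ) (μ : Measure ℝ) : Prop :=
  ∀ x ∈ Ici (0 : ℝ), IntegrableOn (fun t => rpowIntegrand₀₁ p t x) (Ioi 0) μ ∧
    x ^ p = ∫ t in Ioi 0, rpowIntegrand₀₁ p t x ∂μ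

/-- The measure is an argument because one and the same measure must serve operators on two
different spaces when their integrands are compared. -/
lemma rpow_eq_setIntegral {p : ℝ} (hp : p ∈ Ioo 0 1) {μ : Measure ℝ} (hμ : IsRepresenting p μ)
    {a : H →L[ℂ] H} (ha : 0 ≤ a) :
    IntegrableOn (fun t => cfcₙ (rpowIntegrand₀₁ p t) a) (Ioi 0) μ ∧
      a ^ p = ∫ t in Ioi 0, cfcₙ (rpowIntegrand₀₁ p t) a ∂μ := by
  have hq : ∀ x ∈ quasispectrum ℝ a, 0 ≤ x := quasispectrum_nonneg_of_nonneg a ha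
  let f t := rpowIntegrand₀₁ p t
  let maxr := sSup (quasispectrum ℝ a)
  have maxr_nonneg : 0 ≤ maxr :=
    le_csSup_of_le (b := 0) (IsCompact.bddAbove (quasispectrum.isCompact _)) (by simp) le_rfl
  let bound (t : ℝ) := ‖f t maxr‖
  have hf : ContinuousOn (Function.uncurry f) (Ioi (0 : ℝ) ×ˢ quasispectrum ℝ a) :=
    continuousOn_rpowIntegrand₀₁_uncurry hp (quasispectrum ℝ a) hq
  have hbound : ∀ᵐ t ∂μ.restrict (Ioi 0), ∀ z ∈ quasispectrum ℝ a, ‖f t z‖ ≤ bound t := by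
    filter_upwards [ae_restrict_mem measurableSet_Ioi] with t ht
    intro z hz
    have hz' : 0 ≤ z := hq z hz
    unfold bound f
    rw [Real.norm_of_nonneg (rpowIntegrand₀₁_nonneg hp.1 (le_of_lt ht) hz'),
        Real.norm_of_nonneg (rpowIntegrand₀₁_nonneg hp.1 (le_of_lt ht) maxr_nonneg)]
    refine rpowIntegrand₀₁_monotoneOn hp (le_of_lt ht) hz' maxr_nonneg ?_
    exact le_csSup (IsCompact.bddAbove (quasispectrum.isCompact _)) hz
  have hbound_finite_integral : HasFiniteIntegral bound (μ.restrict (Ioi 0)) := by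
    rw [hasFiniteIntegral_norm_iff]
    exact (hμ maxr maxr_nonneg).1.2
  have hmapzero : ∀ᵐ (x : ℝ) ∂μ.restrict (Ioi 0), rpowIntegrand₀₁ p x 0 = 0 := by
    filter_upwards [ae_restrict_mem measurableSet_Ioi]
    simp
  refine ⟨integrableOn_cfcₙ measurableSet_Ioi _ bound a hf hmapzero hbound hbound_finite_integral,
    ?_⟩
  have h0 : (0 : ℝ) ^ p = 0 := Real.zero_rpow hp.1.ne'
  calc
    a ^ p = cfcₙ (fun r => ∫ t in Ioi 0, rpowIntegrand₀₁ p t r ∂μ) a := by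
      rw [rpow_eq_cfc a ha, ← cfcₙ_eq_cfc
        (hf := (Real.continuous_rpow_const hp.1.le).continuousOn) (hf0 := h0)]
      exact cfcₙ_congr fun r hr ↦ (hμ r (hq r hr)).2
    _ = _ := cfcₙ_setIntegral measurableSet_Ioi _ bound a hf hmapzero hbound
                hbound_finite_integral ha.isSelfAdjoint

lemma rip_rpow_eq_setIntegral {p : ℝ} (hp : p ∈ Ioo 0 1) {μ : Measure ℝ}
    (hμ : IsRepresenting p μ) {S : H →L[ℂ] H} (hS : 0 ≤ S) (v u : H) :
    IntegrableOn (fun t => t ^ (p - 1) * rip v ((1 - t • resolv S t) u)) (Ioi 0) μ ∧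
      rip v ((S ^ p) u) = ∫ t in Ioi 0, t ^ (p - 1) * rip v ((1 - t • resolv S t) u) ∂μ := by
  obtain ⟨h1, h2⟩ := rpow_eq_setIntegral hp hμ hS
  let L : (H →L[ℂ] H) →L[ℝ] ℝ :=
    (Complex.reCLM ∘L (innerSL ℂ v).restrictScalars ℝ) ∘L
      (ContinuousLinearMap.apply ℂ H u).restrictScalars ℝ
  have hL : ∀ T : H →L[ℂ] H, L T = rip v (T u) := fun T => rfl
  have e : ∀ t ∈ Ioi (0 : ℝ), L (cfcₙ (rpowIntegrand₀₁ p t) S) =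
      t ^ (p - 1) * rip v ((1 - t • resolv S t) u) := by
    intro t ht
    rw [cfcₙ_rpowIntegrand_eq hS hp ht, map_smul, hL, smul_eq_mul]
  constructor
  · exact (integrableOn_congr_fun e measurableSet_Ioi).1 (L.integrable_comp h1)
  · rw [← hL, h2, ← L.integral_comp_comm h1]
    exact setIntegral_congr_fun measurableSet_Ioi e

end Resolvent

/-! ### Monotonicity under partial traces -/

section Coupling

open MeasureTheory Set

variable {H K : Type*} [NormedAddCommGroup H] [InnerProductSpace ℂ H] [CompleteSpace H]
  [NormedAddCommGroup K] [InnerProductSpace ℂ K] [CompleteSpace K]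
  {F J I : Type*} [Fintype F] [Fintype J] [Fintype I]

/-- The vector `∑ ψ i (l, j) • a l (v j)`. -/
def lift (a : F → K →L[ℂ] H) (ψ : I → F × J → ℂ) (v : J → K) (i : I) : H :=
  ∑ q : F × J, ψ i q • a q.1 (v q.2)

/-- The operator `∑ (a l)† B (a l)`. -/
def compress (a : F → K →L[ℂ] H) (B : H →L[ℂ] H) : K →L[ℂ] K :=
  ∑ l, (a l).adjoint ∘L B ∘L a l

lemma compress_nonneg (a : F → K →L[ℂ] H) {B : H →L[ℂ] H} (hB : 0 ≤ B) : 0 ≤ compress a B :=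
  Finset.sum_nonneg fun _ _ => adjoint_comp_nonneg _ hB

lemma inner_compress (a : F → K →L[ℂ] H) (B : H →L[ℂ] H) (x y : K) :
    ⟪x, compress a B y⟫_ℂ = ∑ l, ⟪a l x, B (a l y)⟫_ℂ := by
  simp [compress, sum_apply, ContinuousLinearMap.adjoint_inner_right]

lemma lift_sub (a : F → K →L[ℂ] H) (ψ : I → F × J → ℂ) (v w : J → K) (i : I) :
    lift a ψ (v - w) i = lift a ψ v i - lift a ψ w i := by
  simp [lift, smul_sub]

variable [DecidableEq F] [DecidableEq J]

/-- The eigenvector coefficients `ψ` of a positive definite matrix on `ℂ^F ⊗ ℂ^J` with eigenvalues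
`ω`, in a basis of `ℂ^J` in which the marginal on `ℂ^J` is diagonal with eigenvalues `ω'`. -/
structure IsCoupling (ψ : I → F × J → ℂ) (ω : I → ℝ) (ω' : J → ℝ) : Prop where
  pos : ∀ i, 0 < ω i
  pos' : ∀ j, 0 < ω' j
  unitary : ∀ q q', ∑ i, (starRingEnd ℂ) (ψ i q) * ψ i q' = if q = q' then 1 else 0
  marginal : ∀ j j', ∑ i, ∑ l, (ω i : ℂ) * ((starRingEnd ℂ) (ψ i (l, j)) * ψ i (l, j')) =
    if j = j' then (ω' j : ℂ) else 0
  total : ∑ j, ω' j = ∑ i, ω i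

variable {ψ : I → F × J → ℂ} {ω : I → ℝ} {ω' : J → ℝ}

/-- Unitarity of `ψ` leaves only the diagonal terms `q = q'` after summing over `i`. -/
lemma sum_inner_lift (h : IsCoupling ψ ω ω') (a : F → K →L[ℂ] H) (B : H →L[ℂ] H) (v w : J → K) :
    ∑ i, ⟪lift a ψ v i, B (lift a ψ w i)⟫_ℂ = ∑ j, ⟪v j, compress a B (w j)⟫_ℂ := by
  have e : ∀ i, ⟪lift a ψ v i, B (lift a ψ w i)⟫_ℂ = ∑ q, ∑ q',
      ((starRingEnd ℂ) (ψ i q) * ψ i q') * ⟪a q.1 (v q.2), B (a q'.1 (w q'.2))⟫_ℂ := by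
    intro i
    rw [lift, lift, map_sum, sum_inner]
    refine Finset.sum_congr rfl fun q _ => ?_
    rw [inner_sum]
    refine Finset.sum_congr rfl fun q' _ => ?_
    rw [map_smul, inner_smul_left, inner_smul_right]
    ring
  simp only [e]
  rw [Finset.sum_comm]
  have e2 : ∀ q, ∑ i, ∑ q', ((starRingEnd ℂ) (ψ i q) * ψ i q') *
      ⟪a q.1 (v q.2), B (a q'.1 (w q'.2))⟫_ℂ = ⟪a q.1 (v q.2), B (a q.1 (w q.2))⟫_ℂ := by
    intro q
    rw [Finset.sum_comm]
    simp only [← Finset.sum_mul, h.unitary]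
    simp
  simp only [e2, inner_compress]
  rw [Fintype.sum_prod_type_right]

/-- The ranges of the isometries `a l` are mutually orthogonal, so what remains after expansion is
the weighted sum over `i` and `l` that defines the marginal. -/
lemma sum_norm_lift (h : IsCoupling ψ ω ω') {a : F → K →L[ℂ] H}
    (ha : ∀ l l' x y, ⟪a l x, a l' y⟫_ℂ = if l = l' then ⟪x, y⟫_ℂ else 0) (v : J → K) :
    ∑ i, ω i * ‖lift a ψ v i‖ ^ 2 = ∑ j, ω' j * ‖v j‖ ^ 2 := by
  have e : ∀ i, ⟪lift a ψ v i, lift a ψ v i⟫_ℂ = ∑ j, ∑ j', ∑ l,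
      ((starRingEnd ℂ) (ψ i (l, j)) * ψ i (l, j')) * ⟪v j, v j'⟫_ℂ := by
    intro i
    rw [lift, sum_inner, Fintype.sum_prod_type_right]
    refine Finset.sum_congr rfl fun j _ => ?_
    rw [Finset.sum_comm]
    refine Finset.sum_congr rfl fun l _ => ?_
    rw [inner_sum, Fintype.sum_prod_type_right]
    refine Finset.sum_congr rfl fun j' _ => ?_
    simp only [inner_smul_left, inner_smul_right, ha]
    rw [Finset.sum_eq_single l (fun l' _ hl => by simp [hl.symm]) (by simp)]
    simp only [if_true]
    ring
  have e2 : ((∑ i, ω i * ‖lift a ψ v i‖ ^ 2 : ℝ) : ℂ) = ((∑ j, ω' j * ‖v j‖ ^ 2 : ℝ) : ℂ) := by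
    push_cast
    have n1 : ∀ x : H, ((‖x‖ : ℝ) : ℂ) ^ 2 = ⟪x, x⟫_ℂ :=
      fun x => (inner_self_eq_norm_sq_to_K (𝕜 := ℂ) x).symm
    have n2 : ∀ x : K, ((‖x‖ : ℝ) : ℂ) ^ 2 = ⟪x, x⟫_ℂ :=
      fun x => (inner_self_eq_norm_sq_to_K (𝕜 := ℂ) x).symm
    simp only [n1, n2, e, Finset.mul_sum]
    rw [Finset.sum_comm]
    refine Finset.sum_congr rfl fun j _ => ?_
    rw [Finset.sum_comm]
    have e3 : ∀ j', ∑ i, ∑ l, (ω i : ℂ) * (((starRingEnd ℂ) (ψ i (l, j)) * ψ i (l, j')) *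
        ⟪v j, v j'⟫_ℂ) = (if j = j' then (ω' j : ℂ) else 0) * ⟪v j, v j'⟫_ℂ := by
      intro j'
      rw [← h.marginal j j', Finset.sum_mul]
      refine Finset.sum_congr rfl fun i _ => ?_
      rw [Finset.sum_mul]
      exact Finset.sum_congr rfl fun l _ => by ring
    simp only [e3]
    simp
  exact_mod_cast e2

lemma sum_qform_lift (h : IsCoupling ψ ω ω') (a : F → K →L[ℂ] H) (B : H →L[ℂ] H) (v : J → K) :
    ∑ i, qform B (lift a ψ v i) = ∑ j, qform (compress a B) (v j) := by
  simp only [qform, ← map_sum, sum_inner_lift h]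

lemma smul_nonneg_op {T : H →L[ℂ] H} (hT : 0 ≤ T) {c : ℝ} (hc : 0 ≤ c) : 0 ≤ c • T := by
  have h := (ContinuousLinearMap.nonneg_iff_isPositive T).1 hT
  have h2 := h.smul_of_nonneg (c := (c : ℂ)) (RCLike.ofReal_nonneg.2 hc)
  have e : c • T = (c : ℂ) • T := by ext x; simp
  rwa [e, ContinuousLinearMap.nonneg_iff_isPositive]

/-- Monotonicity under partial traces of the parallel sum. -/
lemma sum_resolv_le (h : IsCoupling ψ ω ω') {a : F → K →L[ℂ] H}
    (ha : ∀ l l' x y, ⟪a l x, a l' y⟫_ℂ = if l = l' then ⟪x, y⟫_ℂ else 0) {B : H →L[ℂ] H}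
    (hB : 0 ≤ B) (c : J → K) {t : ℝ} (ht : 0 < t) :
    ∑ i, ω i * qform (1 - t • resolv ((ω i)⁻¹ • B) t) (lift a ψ c i) ≤
      ∑ j, ω' j * qform (1 - t • resolv ((ω' j)⁻¹ • compress a B) t) (c j) := by
  have hb := compress_nonneg a hB
  set b := compress a B with hbdef
  -- The minimizers of the variational problem downstairs; their lift is the test family upstairs.
  let z : J → K := fun j => t • resolv ((ω' j)⁻¹ • b) t (c j)
  have h1 : ∀ i, ω i * qform (1 - t • resolv ((ω i)⁻¹ • B) t) (lift a ψ c i) ≤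
      ω i * ‖lift a ψ (c - z) i‖ ^ 2 + t⁻¹ * qform B (lift a ψ z i) := by
    intro i
    have hω := h.pos i
    have := mul_le_mul_of_nonneg_left (qform_resolv_le (smul_nonneg_op hB (inv_nonneg.2 hω.le)) ht
      (lift a ψ c i) (lift a ψ z i)) hω.le
    rw [qform_smul] at this
    refine this.trans (le_of_eq ?_)
    rw [lift_sub]
    field_simp
  refine (Finset.sum_le_sum fun i _ => h1 i).trans (le_of_eq ?_)
  rw [Finset.sum_add_distrib, sum_norm_lift h ha, ← Finset.mul_sum, sum_qform_lift h, ← hbdef,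
    Finset.mul_sum, ← Finset.sum_add_distrib]
  refine Finset.sum_congr rfl fun j _ => ?_
  have hω := h.pos' j
  rw [qform_resolv_eq (smul_nonneg_op hb (inv_nonneg.2 hω.le)) ht, qform_smul]
  simp only [Pi.sub_apply, z]
  field_simp

lemma smul_rpow {T : H →L[ℂ] H} (hT : 0 ≤ T) {c : ℝ} (hc : 0 ≤ c) {s : ℝ} (hs : 0 ≤ s) :
    (c • T) ^ s = c ^ s • T ^ s := by
  rw [rpow_eq_cfc _ (smul_nonneg_op hT hc), rpow_eq_cfc T hT]
  have hcont : Continuous (fun x : ℝ => x ^ s) := Real.continuous_rpow_const hs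
  rw [← cfc_comp_smul c (fun x : ℝ => x ^ s) T hcont.continuousOn,
    ← cfc_smul (c ^ s) (fun x : ℝ => x ^ s) T hcont.continuousOn]
  refine cfc_congr fun x hx => ?_
  simp only [smul_eq_mul]
  exact Real.mul_rpow hc (spectrum_nonneg_of_nonneg hT hx)

lemma exists_isRepresenting {p : ℝ} (hp : p ∈ Ioo (0 : ℝ) 1) : ∃ μ, IsRepresenting p μ :=
  Real.exists_measure_rpow_eq_integral_rpowIntegrand₀₁ hp

/-- This is `w^(1-p) T^p = w (T/w)^p` with the resolvent integral inserted. -/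
lemma weighted_rpow_eq_setIntegral {p : ℝ} (hp : p ∈ Ioo (0 : ℝ) 1) {μ : Measure ℝ}
    (hμ : IsRepresenting p μ) {T : H →L[ℂ] H} (hT : 0 ≤ T) {w : ℝ} (hw : 0 < w) (u : H) :
    IntegrableOn (fun t => t ^ (p - 1) * (w * qform (1 - t • resolv (w⁻¹ • T) t) u)) (Ioi 0) μ ∧
    w ^ (1 - p) * qform (T ^ p) u =
      ∫ t in Ioi 0, t ^ (p - 1) * (w * qform (1 - t • resolv (w⁻¹ • T) t) u) ∂μ := by
  obtain ⟨h1, h2⟩ := rip_rpow_eq_setIntegral hp hμ (smul_nonneg_op hT (inv_nonneg.2 hw.le)) u u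
  simp only [mul_left_comm _ w]
  refine ⟨h1.const_mul w, ?_⟩
  rw [integral_const_mul]
  simp only [qform_eq_rip]
  rw [← h2, smul_rpow hT (inv_nonneg.2 hw.le) hp.1.le, Real.inv_rpow hw.le,
    smul_apply, rip_smul_right, Real.rpow_sub hw, Real.rpow_one]
  ring

lemma mul_rpow_self {T : H →L[ℂ] H} (hT : 0 ≤ T) {p : ℝ} (hp : 0 ≤ p) :
    T * T ^ p = T ^ (1 + p) := by
  have hc : Continuous (fun x : ℝ => x ^ p) := Real.continuous_rpow_const hp
  rw [rpow_eq_cfc T hT, rpow_eq_cfc T hT]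
  nth_rewrite 1 [← cfc_id' ℝ T]
  rw [← cfc_mul (fun x : ℝ => x) _ T (by fun_prop) hc.continuousOn]
  refine cfc_congr fun x hx => ?_
  have := spectrum_nonneg_of_nonneg hT hx
  rw [Real.rpow_add_of_nonneg this zero_le_one hp, Real.rpow_one]

/-- Here `w^(-p) T^(1+p) = T (T/w)^p`, and `T S (t + S)⁻¹ = T - t w S (t + S)⁻¹` for `S = T/w`. The
minus sign is what reverses the monotonicity for exponents above one. -/
lemma weighted_rpow_one_add_eq_setIntegral {p : ℝ} (hp : p ∈ Ioo (0 : ℝ) 1) {μ : Measure ℝ}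
    (hμ : IsRepresenting p μ) {T : H →L[ℂ] H} (hT : 0 ≤ T) {w : ℝ} (hw : 0 < w) (u : H) :
    IntegrableOn (fun t => t ^ (p - 1) *
      (qform T u - t * (w * qform (1 - t • resolv (w⁻¹ • T) t) u))) (Ioi 0) μ ∧
    w ^ (-p) * qform (T ^ (1 + p)) u = ∫ t in Ioi 0, t ^ (p - 1) *
      (qform T u - t * (w * qform (1 - t • resolv (w⁻¹ • T) t) u)) ∂μ := by
  have hS := smul_nonneg_op hT (inv_nonneg.2 hw.le)
  obtain ⟨h1, h2⟩ := rip_rpow_eq_setIntegral hp hμ hS (T u) u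
  have e : ∀ t ∈ Ioi (0 : ℝ), t ^ (p - 1) * rip (T u) ((1 - t • resolv (w⁻¹ • T) t) u) =
      t ^ (p - 1) * (qform T u - t * (w * qform (1 - t • resolv (w⁻¹ • T) t) u)) := by
    intro t ht
    congr 1
    have h3 := apply_resolv hS ht u
    rw [qform_one_sub_resolv]
    simp only [sub_apply, one_apply_eq_self, smul_apply] at h3 ⊢
    generalize resolv (w⁻¹ • T) t u = y at h3
    have h4 : T y = w • (u - t • y) := by
      rw [← h3, smul_smul, mul_inv_cancel₀ hw.ne', one_smul]
    rw [rip_symm_of_nonneg hT, map_sub, map_real_smul, h4, rip_sub_right, rip_smul_right,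
      rip_smul_right, rip_sub_right, rip_smul_right, rip_self, qform_eq_rip]
  refine ⟨(integrableOn_congr_fun e measurableSet_Ioi).1 h1, ?_⟩
  rw [← setIntegral_congr_fun measurableSet_Ioi e, ← h2, smul_rpow hT (inv_nonneg.2 hw.le) hp.1.le,
    Real.inv_rpow hw.le, smul_apply, rip_smul_right, Real.rpow_neg hw.le,
    rip_symm_of_nonneg hT, ← mul_apply_eq_comp, mul_rpow_self hT hp.1.le, qform_eq_rip]

/-- Monotonicity under partial traces of `Tr B ^ r W ^ (1 - r)` for `0 < r ≤ 1`. -/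
lemma sum_rpow_le_of_le_one (h : IsCoupling ψ ω ω') {a : F → K →L[ℂ] H}
    (ha : ∀ l l' x y, ⟪a l x, a l' y⟫_ℂ = if l = l' then ⟪x, y⟫_ℂ else 0) {B : H →L[ℂ] H}
    (hB : 0 ≤ B) (c : J → K) {r : ℝ} (hr : 0 < r) (hr1 : r ≤ 1) :
    ∑ i, ω i ^ (1 - r) * qform (B ^ r) (lift a ψ c i) ≤
      ∑ j, ω' j ^ (1 - r) * qform (compress a B ^ r) (c j) := by
  have hb := compress_nonneg a hB
  rcases hr1.eq_or_lt with rfl | hr1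
  · simp only [sub_self, Real.rpow_zero, one_mul, CFC.rpow_one B hB,
      CFC.rpow_one (compress a B) hb, sum_qform_lift h]
    exact le_rfl
  have hp : r ∈ Ioo (0 : ℝ) 1 := ⟨hr, hr1⟩
  obtain ⟨μ, hμ⟩ := exists_isRepresenting hp
  have hi := fun i => weighted_rpow_eq_setIntegral hp hμ hB (h.pos i) (lift a ψ c i)
  have hj := fun j => weighted_rpow_eq_setIntegral hp hμ hb (h.pos' j) (c j)
  rw [Finset.sum_congr rfl fun i _ => (hi i).2, Finset.sum_congr rfl fun j _ => (hj j).2,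
    ← integral_finsetSum _ fun i _ => (hi i).1, ← integral_finsetSum _ fun j _ => (hj j).1]
  refine setIntegral_mono_on (integrable_finsetSum _ fun i _ => (hi i).1)
    (integrable_finsetSum _ fun j _ => (hj j).1) measurableSet_Ioi fun t ht => ?_
  rw [← Finset.mul_sum, ← Finset.mul_sum]
  exact mul_le_mul_of_nonneg_left (sum_resolv_le h ha hB c ht)
    (Real.rpow_nonneg (le_of_lt ht) _)

lemma rip_two_sub_le {w : ℝ} (hw : 0 < w) (x y : H) :
    2 * rip x y - w * ‖x‖ ^ 2 ≤ w⁻¹ * ‖y‖ ^ 2 := by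
  have h : 0 ≤ w⁻¹ * rip (w • x - y) (w • x - y) := by
    rw [rip_self]; positivity
  rw [← rip_self, ← rip_self]
  simp only [rip_sub_left, rip_sub_right, rip_smul_left, rip_smul_right] at h
  rw [rip_comm y x] at h
  have e : w⁻¹ * (w * (w * rip x x - rip x y) - (w * rip x y - rip y y)) =
      w * rip x x - 2 * rip x y + w⁻¹ * rip y y := by field_simp; ring
  rw [e] at h
  linarith

/-- Monotonicity under partial traces of `Tr B ^ 2 W⁻¹`. -/
lemma sum_sq_le (h : IsCoupling ψ ω ω') {a : F → K →L[ℂ] H}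
    (ha : ∀ l l' x y, ⟪a l x, a l' y⟫_ℂ = if l = l' then ⟪x, y⟫_ℂ else 0) (B : H →L[ℂ] H)
    (c : J → K) :
    ∑ j, (ω' j)⁻¹ * ‖compress a B (c j)‖ ^ 2 ≤ ∑ i, (ω i)⁻¹ * ‖B (lift a ψ c i)‖ ^ 2 := by
  -- With this `z` the quadratic bound `rip_two_sub_le` is an equality downstairs; upstairs its lift
  -- gives a lower bound.
  let z : J → K := fun j => (ω' j)⁻¹ • compress a B (c j)
  have h1 := Finset.sum_le_sum fun i (_ : i ∈ Finset.univ) =>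
    rip_two_sub_le (h.pos i) (lift a ψ z i) (B (lift a ψ c i))
  refine le_trans (le_of_eq ?_) h1
  have h2 : ∑ i, rip (lift a ψ z i) (B (lift a ψ c i)) = ∑ j, rip (z j) (compress a B (c j)) := by
    simp only [rip, ← map_sum, sum_inner_lift h]
  rw [Finset.sum_sub_distrib, sum_norm_lift h ha, ← Finset.mul_sum, h2, Finset.mul_sum,
    ← Finset.sum_sub_distrib]
  refine Finset.sum_congr rfl fun j _ => ?_
  have hω := h.pos' j
  simp only [z, ← rip_self, rip_smul_left, rip_smul_right]
  field_simp
  ring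

/-- Monotonicity under partial traces of `Tr B ^ r W ^ (1 - r)` for `1 ≤ r ≤ 2`. -/
lemma sum_rpow_le_of_one_le (h : IsCoupling ψ ω ω') {a : F → K →L[ℂ] H}
    (ha : ∀ l l' x y, ⟪a l x, a l' y⟫_ℂ = if l = l' then ⟪x, y⟫_ℂ else 0) {B : H →L[ℂ] H}
    (hB : 0 ≤ B) (c : J → K) {r : ℝ} (hr : 1 ≤ r) (hr2 : r ≤ 2) :
    ∑ j, ω' j ^ (1 - r) * qform (compress a B ^ r) (c j) ≤
      ∑ i, ω i ^ (1 - r) * qform (B ^ r) (lift a ψ c i) := by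
  have hb := compress_nonneg a hB
  rcases hr.eq_or_lt with rfl | hr
  · simp only [sub_self, Real.rpow_zero, one_mul, CFC.rpow_one B hB,
      CFC.rpow_one (compress a B) hb, sum_qform_lift h]
    exact le_rfl
  rcases hr2.eq_or_lt with rfl | hr2
  -- The exponent `r - 1 = 1` lies outside the range of the integral representation, so `r = 2` is
  -- handled by `sum_sq_le`.
  · have e : (1 : ℝ) - 2 = -1 := by norm_num
    have e1 : ∀ x, qform (B ^ (2 : ℝ)) x = ‖B x‖ ^ 2 := fun x => by
      rw [← one_add_one_eq_two, ← mul_rpow_self hB zero_le_one, CFC.rpow_one B hB, qform_eq_rip,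
        mul_apply_eq_comp, ← rip_symm_of_nonneg hB, rip_self]
    have e2 : ∀ x, qform (compress a B ^ (2 : ℝ)) x = ‖compress a B x‖ ^ 2 := fun x => by
      rw [← one_add_one_eq_two, ← mul_rpow_self hb zero_le_one, CFC.rpow_one _ hb, qform_eq_rip,
        mul_apply_eq_comp, ← rip_symm_of_nonneg hb, rip_self]
    simp only [e, Real.rpow_neg_one, e1, e2]
    exact sum_sq_le h ha B c
  have hp : r - 1 ∈ Ioo (0 : ℝ) 1 := ⟨by linarith, by linarith⟩
  obtain ⟨μ, hμ⟩ := exists_isRepresenting hp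
  have hi := fun i => weighted_rpow_one_add_eq_setIntegral hp hμ hB (h.pos i) (lift a ψ c i)
  have hj := fun j => weighted_rpow_one_add_eq_setIntegral hp hμ hb (h.pos' j) (c j)
  simp only [neg_sub, add_sub_cancel] at hi hj
  rw [Finset.sum_congr rfl fun i _ => (hi i).2, Finset.sum_congr rfl fun j _ => (hj j).2,
    ← integral_finsetSum _ fun i _ => (hi i).1, ← integral_finsetSum _ fun j _ => (hj j).1]
  refine setIntegral_mono_on (integrable_finsetSum _ fun j _ => (hj j).1)
    (integrable_finsetSum _ fun i _ => (hi i).1) measurableSet_Ioi fun t ht => ?_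
  rw [← Finset.mul_sum, ← Finset.mul_sum]
  refine mul_le_mul_of_nonneg_left ?_ (Real.rpow_nonneg (le_of_lt ht) _)
  rw [Finset.sum_sub_distrib, Finset.sum_sub_distrib, sum_qform_lift h, ← Finset.mul_sum,
    ← Finset.mul_sum]
  exact sub_le_sub_left (mul_le_mul_of_nonneg_left (sum_resolv_le h ha hB c ht) (le_of_lt ht)) _

end Coupling

/-! ### Slices and product bases of Hilbert tensor products -/

section Tensor

variable {E F G : Type*} [NormedAddCommGroup E] [InnerProductSpace ℂ E]
  [NormedAddCommGroup F] [InnerProductSpace ℂ F] [NormedAddCommGroup G] [InnerProductSpace ℂ G]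

lemma inner_htmul (x x' : E) (y y' : F) :
    ⟪htmul x y, htmul x' y'⟫_ℂ = ⟪x, x'⟫_ℂ * ⟪y, y'⟫_ℂ := by
  exact (UniformSpace.Completion.inner_coe _ _).trans (TensorProduct.inner_tmul ..)

/-- The embedding of the algebraic tensor product. -/
def ofTensor : E ⊗[ℂ] F →L[ℂ] HTensor E F :=
  (UniformSpace.Completion.toComplL : E ⊗[ℂ] F →L[ℂ] UniformSpace.Completion (E ⊗[ℂ] F))

lemma denseRange_ofTensor : DenseRange (ofTensor : E ⊗[ℂ] F →L[ℂ] HTensor E F) :=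
  UniformSpace.Completion.denseRange_coe

/-- The map `y ↦ x ⊗ y`. -/
def slice (x : E) : F →L[ℂ] HTensor E F := ofTensor ∘L TensorProduct.mkL ℂ E F x

lemma slice_apply (x : E) (y : F) : slice x y = htmul x y := rfl

/-- The map `x ⊗ z ↦ x ⊗ (y ⊗ z)`. -/
def insertMid (y : F) : HTensor E G →L[ℂ] HTensor E (HTensor F G) :=
  ((slice y : G →L[ℂ] HTensor F G).lTensor E).completion

lemma insertMid_htmul (y : F) (x : E) (z : G) :
    insertMid y (htmul x z) = htmul x (htmul y z) := by
  exact ContinuousLinearMap.completion_apply_coe _ _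

lemma span_htmul_topologicalClosure :
    (Submodule.span ℂ (Set.range fun q : E × F => htmul q.1 q.2)).topologicalClosure = ⊤ := by
  rw [← Submodule.dense_iff_topologicalClosure_eq_top]
  refine denseRange_ofTensor.mono ?_
  rintro _ ⟨u, rfl⟩
  induction u using TensorProduct.induction_on with
  | zero => rw [map_zero]; exact Submodule.zero_mem _
  | tmul x y => exact Submodule.subset_span ⟨(x, y), rfl⟩
  | add u v hu hv => rw [map_add]; exact Submodule.add_mem _ hu hv

lemma orthonormal_htmul {ι κ : Type*} {e : ι → E} {f : κ → F} (he : Orthonormal ℂ e)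
    (hf : Orthonormal ℂ f) : Orthonormal ℂ (fun q : ι × κ => htmul (e q.1) (f q.2)) := by
  classical
  rw [orthonormal_iff_ite] at *
  rintro ⟨i, k⟩ ⟨i', k'⟩
  rw [inner_htmul, he, hf]
  by_cases h1 : i = i' <;> by_cases h2 : k = k' <;> simp [h1, h2]

/-- The product Hilbert basis of `E ⊗ F`. -/
def prodBasis {ι κ : Type*} (e : HilbertBasis ι ℂ E) (f : HilbertBasis κ ℂ F) :
    HilbertBasis (ι × κ) ℂ (HTensor E F) :=
  HilbertBasis.mk (orthonormal_htmul e.orthonormal f.orthonormal) (by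
    set S := (Submodule.span ℂ
      (Set.range fun q : ι × κ => htmul (e q.1) (f q.2))).topologicalClosure with hS
    have hcl : IsClosed (S : Set (HTensor E F)) := Submodule.isClosed_topologicalClosure _
    have h1 : ∀ (i : ι) (y : F), htmul (e i) y ∈ S := by
      intro i y
      have h := (f.hasSum_repr y).mapL (slice (e i))
      refine hcl.mem_of_tendsto h (Eventually.of_forall fun s => ?_)
      refine Submodule.sum_mem _ fun k _ => ?_
      rw [map_smul]
      exact Submodule.smul_mem _ _
        (Submodule.le_topologicalClosure _ (Submodule.subset_span ⟨(i, k), rfl⟩))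
    have h2 : ∀ (x : E) (y : F), htmul x y ∈ S := by
      intro x y
      have h := (e.hasSum_repr x).mapL (ofTensor ∘L (TensorProduct.mkL ℂ E F).flip y)
      refine hcl.mem_of_tendsto h (Eventually.of_forall fun s => ?_)
      refine Submodule.sum_mem _ fun k _ => ?_
      rw [map_smul]
      exact Submodule.smul_mem _ _ (h1 k y)
    rw [← span_htmul_topologicalClosure]
    refine Submodule.topologicalClosure_minimal _ ?_ hcl
    rw [Submodule.span_le]
    rintro _ ⟨q, rfl⟩
    exact h2 _ _)

lemma prodBasis_apply {ι κ : Type*} (e : HilbertBasis ι ℂ E) (f : HilbertBasis κ ℂ F)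
    (q : ι × κ) : prodBasis e f q = htmul (e q.1) (f q.2) := by
  rw [prodBasis, HilbertBasis.coe_mk]

end Tensor

/-! ### Finite matrices: diagonalization and construction of couplings -/

section Diagonalization

open Matrix

variable {H K : Type*} [NormedAddCommGroup H] [InnerProductSpace ℂ H] [CompleteSpace H]
  [NormedAddCommGroup K] [InnerProductSpace ℂ K] [CompleteSpace K]
  {n F M : Type*} [Fintype n] [DecidableEq n] [Fintype F] [DecidableEq F] [Fintype M]
  [DecidableEq M]

lemma exists_diagonalization {A : Matrix n n ℂ} (hA : A.IsHermitian) :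
    ∃ (U : Matrix n n ℂ) (x : n → ℝ), Uᴴ * U = 1 ∧ U * Uᴴ = 1 ∧
      Uᴴ * A * U = diagonal fun i => (x i : ℂ) := by
  refine ⟨hA.eigenvectorUnitary, hA.eigenvalues, ?_, ?_, ?_⟩
  · exact Unitary.coe_star_mul_self hA.eigenvectorUnitary
  · exact Unitary.coe_mul_star_self hA.eigenvectorUnitary
  · have := hA.conjStarAlgAut_star_eigenvectorUnitary
    rw [Unitary.conjStarAlgAut_star_apply] at this
    exact this

/-- The linear combinations of the vectors `f` with coefficients the columns of `U`. -/
def comb (U : Matrix n n ℂ) (f : n → H) (i : n) : H := ∑ q, U q i • f q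

/-- The matrix of `T` with respect to the vectors `f`. -/
def gram (T : H →L[ℂ] H) (f : n → H) : Matrix n n ℂ := of fun q q' => ⟪f q, T (f q')⟫_ℂ

lemma gram_isHermitian {T : H →L[ℂ] H} (hT : 0 ≤ T) (f : n → H) : (gram T f).IsHermitian := by
  ext q q'
  simp only [gram, conjTranspose_apply, of_apply, RCLike.star_def, inner_conj_symm]
  exact inner_symm_of_nonneg hT _ _

lemma inner_comb (T : H →L[ℂ] H) (U : Matrix n n ℂ) (f : n → H) (i i' : n) :
    ⟪comb U f i, T (comb U f i')⟫_ℂ = (Uᴴ * gram T f * U) i i' := by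
  simp only [comb, map_sum, map_smul, inner_sum, sum_inner, inner_smul_left, inner_smul_right,
    Matrix.mul_apply, conjTranspose_apply, gram, of_apply, Finset.sum_mul, Finset.mul_sum]
  refine Finset.sum_congr rfl fun q _ => Finset.sum_congr rfl fun q' _ => ?_
  simp only [RCLike.star_def]
  ring

lemma gram_one {f : n → H} (hf : Orthonormal ℂ f) : gram 1 f = 1 := by
  ext q q'
  simp only [gram, of_apply, one_apply_eq_self, orthonormal_iff_ite.1 hf, one_apply]

lemma orthonormal_comb {f : n → H} (hf : Orthonormal ℂ f) {U : Matrix n n ℂ} (hU : Uᴴ * U = 1) :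
    Orthonormal ℂ (comb U f) := by
  rw [orthonormal_iff_ite]
  intro i i'
  have := inner_comb 1 U f i i'
  rw [gram_one hf, mul_one, hU, one_apply_eq_self, one_apply] at this
  exact this

lemma sum_qform_comb (T : H →L[ℂ] H) (f : n → H) {U : Matrix n n ℂ} (hU : U * Uᴴ = 1) :
    ∑ i, qform T (comb U f i) = ∑ q, qform T (f q) := by
  have h : ∑ i, ⟪comb U f i, T (comb U f i)⟫_ℂ = ∑ q, ⟪f q, T (f q)⟫_ℂ := by
    simp only [inner_comb]
    change Matrix.trace (Uᴴ * gram T f * U) = Matrix.trace (gram T f)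
    rw [trace_mul_comm, ← Matrix.mul_assoc, hU, one_mul]
  simp only [qform, ← map_sum, h]

/-- The coefficients of the columns of `U` after the change of basis `V` in the second factor. -/
def couplingCoeff (U : Matrix (F × M) (F × M) ℂ) (V : Matrix M M ℂ) (i : F × M) (q : F × M) : ℂ :=
  ∑ m, star (V m q.2) * U (q.1, m) i

/-- The change of basis in `couplingCoeff` is inverse to the one in `comb V f`, so lifting the
eigenvectors of the marginal gives the eigenvectors encoded by `U`. -/
lemma lift_couplingCoeff (a : F → K →L[ℂ] H) (U : Matrix (F × M) (F × M) ℂ) {V : Matrix M M ℂ}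
    (hV : V * Vᴴ = 1) (f : M → K) (i : F × M) :
    lift a (couplingCoeff U V) (comb V f) i = comb U (fun q => a q.1 (f q.2)) i := by
  simp only [lift, comb, Fintype.sum_prod_type]
  refine Finset.sum_congr rfl fun l _ => ?_
  have hV' : ∀ m m', ∑ j, star (V m j) * V m' j = if m' = m then 1 else 0 := by
    intro m m'
    have := congrFun (congrFun hV m') m
    rw [Matrix.mul_apply, one_apply] at this
    rw [← this]
    exact Finset.sum_congr rfl fun j _ => by rw [conjTranspose_apply]; ring
  simp only [couplingCoeff, map_sum, map_smul, Finset.smul_sum, smul_smul, Finset.sum_mul]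
  rw [Finset.sum_comm]
  have : ∀ m', ∑ j, (∑ m, star (V m j) * U (l, m) i * V m' j) • a l (f m') =
      U (l, m') i • a l (f m') := by
    intro m'
    simp only [← Finset.sum_smul]
    congr 1
    rw [Finset.sum_comm]
    have : ∀ m, ∑ j, star (V m j) * U (l, m) i * V m' j =
        U (l, m) i * if m' = m then 1 else 0 := by
      intro m
      rw [← hV', Finset.mul_sum]
      exact Finset.sum_congr rfl fun j _ => by ring
    simp only [this]
    simp
  exact Finset.sum_congr rfl fun m' _ => this m'

/-- The weights are the eigenvalues of `W = U D Uᴴ`; the unitary `V` diagonalizes its partial trace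
over `ℂ^F`. -/
lemma exists_isCoupling [Nonempty F] {U : Matrix (F × M) (F × M) ℂ} (hU : Uᴴ * U = 1)
    (hU' : U * Uᴴ = 1) {ω : F × M → ℝ} (hω : ∀ i, 0 < ω i) :
    ∃ (V : Matrix M M ℂ) (ω' : M → ℝ), Vᴴ * V = 1 ∧ V * Vᴴ = 1 ∧
      IsCoupling (couplingCoeff U V) ω ω' := by
  let D : Matrix (F × M) (F × M) ℂ := diagonal fun i => (ω i : ℂ)
  let Z : F → Matrix M (F × M) ℂ := fun l => of fun m i => U (l, m) i
  -- `Z l` is the block of rows of `U` with first index `l`, so `w` is the sum of the diagonal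
  -- blocks of `U D Uᴴ`.
  let w : Matrix M M ℂ := ∑ l, Z l * D * (Z l)ᴴ
  have hD : Dᴴ = D := by
    simp only [D, diagonal_conjTranspose]
    congr 1; ext i; simp
  have hw : w.IsHermitian := by
    rw [IsHermitian, conjTranspose_sum]
    refine Finset.sum_congr rfl fun l _ => ?_
    rw [conjTranspose_mul, conjTranspose_mul, conjTranspose_conjTranspose, hD, Matrix.mul_assoc]
  obtain ⟨V, ω', hV, hV', hd⟩ := exists_diagonalization hw
  have hψ : ∀ i l j, couplingCoeff U V i (l, j) = (Vᴴ * Z l) j i := by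
    intro i l j
    simp [couplingCoeff, Matrix.mul_apply, Z]
  have hZ : ∀ l l', Z l' * (Z l)ᴴ = if l' = l then 1 else 0 := by
    intro l l'
    ext m m'
    have := congrFun (congrFun hU' (l', m)) (l, m')
    rw [Matrix.mul_apply] at this
    rw [Matrix.mul_apply]
    refine this.trans ?_
    rw [one_apply]
    by_cases h : l' = l
    · simp [h, one_apply]
    · simp [h]
  have hunit : ∀ q q' : F × M, ∑ i, (starRingEnd ℂ) (couplingCoeff U V i q) *
      couplingCoeff U V i q' = if q = q' then 1 else 0 := by
    rintro ⟨l, j⟩ ⟨l', j'⟩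
    have h1 : ∑ i, (starRingEnd ℂ) (couplingCoeff U V i (l, j)) * couplingCoeff U V i (l', j') =
        ((Vᴴ * Z l') * (Vᴴ * Z l)ᴴ) j' j := by
      rw [Matrix.mul_apply]
      refine Finset.sum_congr rfl fun i _ => ?_
      rw [hψ, hψ, conjTranspose_apply, mul_comm, RCLike.star_def]
    rw [h1, conjTranspose_mul, conjTranspose_conjTranspose, Matrix.mul_assoc, ← Matrix.mul_assoc (Z l'), hZ]
    by_cases h : l' = l
    · simp only [h, if_true, one_mul, hV, one_apply, Prod.mk.injEq, true_and, eq_comm]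
    · simp [h, Ne.symm h]
  have hmarg : ∀ j j', ∑ i, ∑ l, (ω i : ℂ) * ((starRingEnd ℂ) (couplingCoeff U V i (l, j)) *
      couplingCoeff U V i (l, j')) = if j = j' then (ω' j : ℂ) else 0 := by
    intro j j'
    have h1 : Vᴴ * w * V = ∑ l, (Vᴴ * Z l) * D * (Vᴴ * Z l)ᴴ := by
      simp only [w, Finset.mul_sum, Finset.sum_mul]
      refine Finset.sum_congr rfl fun l _ => ?_
      rw [conjTranspose_mul, conjTranspose_conjTranspose]
      simp only [Matrix.mul_assoc]
    have h2 := congrFun (congrFun (h1.symm.trans hd) j') j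
    rw [Matrix.sum_apply, diagonal_apply] at h2
    have h3 : (if j = j' then (ω' j : ℂ) else 0) = if j' = j then (ω' j' : ℂ) else 0 := by
      by_cases h : j = j'
      · simp [h]
      · simp [h, Ne.symm h]
    rw [h3, ← h2, Finset.sum_comm]
    refine Finset.sum_congr rfl fun l _ => ?_
    rw [Matrix.mul_apply]
    refine Finset.sum_congr rfl fun i _ => ?_
    rw [mul_diagonal, hψ, hψ, conjTranspose_apply, RCLike.star_def]
    ring
  have hω' : ∀ j, ω' j = ∑ i, ∑ l, ω i * ‖couplingCoeff U V i (l, j)‖ ^ 2 := by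
    intro j
    have h1 := hmarg j j
    rw [if_pos rfl] at h1
    simp only [← Complex.normSq_eq_conj_mul_self, Complex.normSq_eq_norm_sq] at h1
    exact_mod_cast h1.symm
  refine ⟨V, ω', hV, hV', hω, ?_, hunit, hmarg, ?_⟩
  · intro j
    rw [hω']
    have h0 : 0 ≤ ∑ i, ∑ l, ω i * ‖couplingCoeff U V i (l, j)‖ ^ 2 :=
      Finset.sum_nonneg fun i _ => Finset.sum_nonneg fun l _ =>
        mul_nonneg (hω i).le (by positivity)
    -- A vanishing marginal eigenvalue would kill every coefficient with second index `j`, against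
    -- unitarity; this is where `F` must be nonempty.
    refine h0.lt_of_ne fun h => ?_
    have h2 := (Finset.sum_eq_zero_iff_of_nonneg fun i _ => Finset.sum_nonneg fun l _ =>
        mul_nonneg (hω i).le (by positivity)).1 h.symm
    obtain ⟨l⟩ := ‹Nonempty F›
    have h3 : ∀ i, couplingCoeff U V i (l, j) = 0 := by
      intro i
      have h4 := (Finset.sum_eq_zero_iff_of_nonneg fun l _ =>
        mul_nonneg (hω i).le (by positivity)).1 (h2 i (Finset.mem_univ _)) l (Finset.mem_univ _)
      have := (hω i).ne'
      simpa [this] using h4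
    have h5 := hunit (l, j) (l, j)
    simp [h3] at h5
  · have h1 : Matrix.trace (Vᴴ * w * V) = ∑ j, (ω' j : ℂ) := by rw [hd, trace_diagonal]
    have h2 : Matrix.trace (Vᴴ * w * V) = ∑ i, (ω i : ℂ) := by
      rw [trace_mul_comm, ← Matrix.mul_assoc, hV', one_mul, trace_sum]
      have h3 : ∀ l, Matrix.trace (Z l * D * (Z l)ᴴ) = ∑ i, ∑ m,
          (ω i : ℂ) * (star (U (l, m) i) * U (l, m) i) := by
        intro l
        rw [Matrix.mul_assoc, trace_mul_comm, Matrix.mul_assoc]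
        simp only [Matrix.trace, diag_apply]
        refine Finset.sum_congr rfl fun i _ => ?_
        rw [diagonal_mul, Matrix.mul_apply, Finset.mul_sum]
        rfl
      simp only [h3]
      rw [Finset.sum_comm]
      refine Finset.sum_congr rfl fun i _ => ?_
      have h4 := congrFun (congrFun hU i) i
      rw [Matrix.mul_apply, one_apply_eq, Fintype.sum_prod_type] at h4
      simp only [← Finset.mul_sum]
      simp only [conjTranspose_apply] at h4
      rw [h4, mul_one]
    have h3 := h1.symm.trans h2
    exact_mod_cast h3

end Diagonalization

/-! ### Passing bounds to strong limits; traces of powers of compressions -/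

section Limits

variable {H : Type*} [NormedAddCommGroup H] [InnerProductSpace ℂ H] [CompleteSpace H]

lemma tsum_ofReal_le {ι : Type*} {g : ι → ℝ} (hg : ∀ i, 0 ≤ g i) {C : ℝ}
    (h : ∀ s : Finset ι, ∑ i ∈ s, g i ≤ C) : ∑' i, ENNReal.ofReal (g i) ≤ ENNReal.ofReal C := by
  rw [ENNReal.tsum_eq_iSup_sum]
  refine iSup_le fun s => ?_
  rw [← ENNReal.ofReal_sum_of_nonneg fun i _ => hg i]
  exact ENNReal.ofReal_le_ofReal (h s)

lemma sum_le_of_tsum_ofReal_le {ι : Type*} {g : ι → ℝ} (hg : ∀ i, 0 ≤ g i) {C : ℝ} (hC : 0 ≤ C)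
    (h : ∑' i, ENNReal.ofReal (g i) ≤ ENNReal.ofReal C) (s : Finset ι) : ∑ i ∈ s, g i ≤ C := by
  rw [← ENNReal.ofReal_le_ofReal_iff hC, ENNReal.ofReal_sum_of_nonneg fun i _ => hg i]
  exact (ENNReal.sum_le_tsum s).trans h

lemma tendsto_qform {ι : Type*} {l : Filter ι} {T : ι → H →L[ℂ] H} {S : H →L[ℂ] H} {x : H}
    (h : Tendsto (fun i => T i x) l (𝓝 (S x))) :
    Tendsto (fun i => qform (T i) x) l (𝓝 (qform S x)) := by
  have : Continuous fun y : H => RCLike.re ⟪x, y⟫_ℂ := by fun_prop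
  exact (this.tendsto (S x)).comp h

lemma sum_qform_le_of_tendsto {ι κ : Type*} {l : Filter ι} [l.NeBot] {T : ι → H →L[ℂ] H}
    {S : H →L[ℂ] H} (h : ∀ x, Tendsto (fun i => T i x) l (𝓝 (S x))) {f : κ → H} {C : ℝ}
    (s : Finset κ) (hC : ∀ᶠ i in l, ∑ q ∈ s, qform (T i) (f q) ≤ C) :
    ∑ q ∈ s, qform S (f q) ≤ C :=
  le_of_tendsto (tendsto_finsetSum s fun q _ => tendsto_qform (h (f q))) hC

lemma rpow_mul_rpow {T : H →L[ℂ] H} (hT : 0 ≤ T) {p q : ℝ} (hp : 0 ≤ p) (hq : 0 ≤ q) :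
    T ^ p * T ^ q = T ^ (p + q) := by
  have hcp : Continuous (fun x : ℝ => x ^ p) := Real.continuous_rpow_const hp
  have hcq : Continuous (fun x : ℝ => x ^ q) := Real.continuous_rpow_const hq
  rw [rpow_eq_cfc T hT, rpow_eq_cfc T hT, rpow_eq_cfc T hT,
    ← cfc_mul _ _ T hcp.continuousOn hcq.continuousOn]
  exact cfc_congr fun x hx =>
    (Real.rpow_add_of_nonneg (spectrum_nonneg_of_nonneg hT hx) hp hq).symm

/-- If `X` is diagonal on an orthonormal family, the sum of the powers of its diagonal entries is
at most the trace of the power of `X`. -/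
lemma sum_rpow_qform_le {ι n : Type*} [Fintype n] {X : H →L[ℂ] H} (hX : 0 ≤ X) {h : n → H}
    (ho : Orthonormal ℂ h) (hd : ∀ i i', i ≠ i' → ⟪h i, X (h i')⟫_ℂ = 0) {θ : ℝ} (hθ : 0 < θ)
    (b : HilbertBasis ι ℂ H) :
    ENNReal.ofReal (∑ i, qform X (h i) ^ θ) ≤ ∑' l, ENNReal.ofReal (qform (X ^ θ) (b l)) := by
  classical
  set x : n → ℝ := fun i => qform X (h i) with hx
  have hx0 : ∀ i, 0 ≤ x i := fun i => qform_nonneg hX _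
  have hR : 0 ≤ X ^ (1 / 2 : ℝ) := CFC.rpow_nonneg
  -- For `θ < 1` Jensen's inequality at `h i` goes the wrong way. The normalized vectors `X^(1/2) h
  -- i` are orthonormal because `h` diagonalizes the form of `X`, and at them `X^θ` has form `(x
  -- i)⁻¹ ⟪h i, X^(1+θ) h i⟫`, where Jensen applies with exponent `1 + θ ≥ 1`.
  let v : {i // 0 < x i} → H := fun i => ((x i) ^ (-(1 / 2) : ℝ)) • (X ^ (1 / 2 : ℝ)) (h i)
  have hRR : ∀ y, (X ^ (1 / 2 : ℝ)) ((X ^ (1 / 2 : ℝ)) y) = X y := by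
    intro y
    rw [← mul_apply_eq_comp, rpow_mul_rpow hX (by norm_num) (by norm_num)]
    norm_num [CFC.rpow_one X hX]
  have hsq : ∀ i : {i // 0 < x i}, (x i) ^ (-(1 / 2) : ℝ) * (x i) ^ (-(1 / 2) : ℝ) = (x i)⁻¹ := by
    intro i
    rw [← Real.rpow_add i.2, ← Real.rpow_neg_one]
    norm_num
  have hv : Orthonormal ℂ v := by
    rw [orthonormal_iff_ite]
    intro i i'
    have e : ⟪v i, v i'⟫_ℂ = ((x i ^ (-(1 / 2) : ℝ) * x i' ^ (-(1 / 2) : ℝ) : ℝ) : ℂ) *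
        ⟪h i, X (h i')⟫_ℂ := by
      simp only [v, ← Complex.coe_smul, inner_smul_left, inner_smul_right, Complex.conj_ofReal]
      rw [inner_symm_of_nonneg hR, hRR]
      push_cast; ring
    rw [e]
    by_cases hii : i = i'
    · subst hii
      rw [if_pos rfl, hsq, inner_eq_qform hX]
      have : x i ≠ 0 := i.2.ne'
      rw [← Complex.ofReal_mul]
      change (((x i)⁻¹ * x i : ℝ) : ℂ) = 1
      rw [inv_mul_cancel₀ this, Complex.ofReal_one]
    · rw [if_neg hii, hd _ _ fun h => hii (Subtype.ext h), mul_zero]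
  refine le_trans (ENNReal.ofReal_le_ofReal ?_)
    (sum_qform_le_tsum (CFC.rpow_nonneg (a := X) (y := θ)) hv Finset.univ b)
  have h1 : ∑ i, x i ^ θ = ∑ i : {i // 0 < x i}, x i ^ θ := by
    rw [← Finset.sum_subtype (Finset.univ.filter fun i => 0 < x i) (by simp) fun i => x i ^ θ]
    refine (Finset.sum_filter_of_ne fun i _ hi => (hx0 i).lt_of_ne fun h0 => hi ?_).symm
    rw [← h0, Real.zero_rpow hθ.ne']
  rw [h1]
  refine Finset.sum_le_sum fun i _ => ?_
  have h2 : qform (X ^ θ) (v i) = (x i)⁻¹ * qform (X ^ (1 + θ)) (h i) := by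
    rw [← hsq i]
    simp only [v]
    rw [qform_smul_vec, sq]
    congr 1
    rw [qform_eq_rip, rip_symm_of_nonneg hR, ← mul_apply_eq_comp, ← mul_apply_eq_comp,
      rpow_mul_rpow hX (by norm_num) hθ.le, rpow_mul_rpow hX (by positivity) (by norm_num),
      qform_eq_rip, show (1 / 2 + θ + 1 / 2 : ℝ) = 1 + θ by ring]
  rw [h2]
  have h3 := qform_rpow_ge hX (ho.1 i) (s := 1 + θ) (by linarith)
  change x i ^ (1 + θ) ≤ _ at h3
  rw [Real.rpow_add i.2, Real.rpow_one] at h3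
  rw [le_inv_mul_iff₀ i.2]
  exact h3

end Limits

/-! ### Partial traces as strong limits of finite compressions -/

section PartialTrace

variable {E F G : Type*} [NormedAddCommGroup E] [InnerProductSpace ℂ E] [CompleteSpace E]
  [NormedAddCommGroup F] [InnerProductSpace ℂ F] [CompleteSpace F]
  [NormedAddCommGroup G] [InnerProductSpace ℂ G] [CompleteSpace G]

lemma inner_slice_onb {s : Finset (basisIndex E)} [DecidableEq s] (l l' : s) (x y : F) :
    ⟪slice (onb E l) x, slice (onb E l') y⟫_ℂ = if l = l' then ⟪x, y⟫_ℂ else 0 := by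
  classical
  rw [slice_apply, slice_apply, inner_htmul, orthonormal_iff_ite.1 (onb E).orthonormal]
  by_cases h : l = l'
  · simp [h]
  · simp [h, Subtype.coe_inj.not.2 h]

lemma qform_compress {H K : Type*} [NormedAddCommGroup H] [InnerProductSpace ℂ H] [CompleteSpace H]
    [NormedAddCommGroup K] [InnerProductSpace ℂ K] [CompleteSpace K] {L : Type*} [Fintype L]
    (a : L → K →L[ℂ] H) (B : H →L[ℂ] H) (x : K) :
    qform (compress a B) x = ∑ l, qform B (a l x) := by
  rw [qform, inner_compress, map_sum]; rfl

/-- Common source of both kinds of partial trace: a uniform bound on the truncations yields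
existence and strong convergence together. -/
lemma exists_compress_tendsto {H K : Type*} [NormedAddCommGroup H] [InnerProductSpace ℂ H]
    [CompleteSpace H] [NormedAddCommGroup K] [InnerProductSpace ℂ K] [CompleteSpace K] {ι : Type*}
    (a : ι → K →L[ℂ] H) {B : H →L[ℂ] H} (hB : 0 ≤ B) {C : ℝ} (hC0 : 0 ≤ C)
    (hC : ∀ s : Finset ι, ∀ x, qform (compress (fun l : s => a l) B) x ≤ C * ‖x‖ ^ 2) :
    ∃ S : K →L[ℂ] K, 0 ≤ S ∧ (∀ x y, HasSum (fun i => ⟪a i x, B (a i y)⟫_ℂ) ⟪x, S y⟫_ℂ) ∧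
      ∀ x, Tendsto (fun s : Finset ι => compress (fun l : s => a l) B x) atTop (𝓝 (S x)) := by
  have e : ∀ s : Finset ι, compress (fun l : s => a l) B = ∑ l ∈ s, (a l).adjoint ∘L B ∘L a l :=
    fun s => Finset.sum_coe_sort s fun l => (a l).adjoint ∘L B ∘L a l
  obtain ⟨S, hS, h⟩ := exists_hasSum_apply (fun i => adjoint_comp_nonneg (a i) hB) hC0
    (fun s x => by rw [← e]; exact hC s x)
  refine ⟨S, hS, fun x y => ?_, fun x => ?_⟩
  · have := (h y).mapL (innerSL ℂ x)
    simpa [ContinuousLinearMap.adjoint_inner_right] using this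
  · simp only [e, sum_apply]
    exact h x

lemma exists_isTraceFst {B : HTensor E F →L[ℂ] HTensor E F} (hB : 0 ≤ B) {C : ℝ} (hC0 : 0 ≤ C)
    (hC : ∀ s : Finset (basisIndex E), ∀ x,
      qform (compress (fun l : s => (slice (onb E l) : F →L[ℂ] _)) B) x ≤ C * ‖x‖ ^ 2) :
    ∃ S : F →L[ℂ] F, 0 ≤ S ∧ IsTraceFst B S ∧ ∀ x, Tendsto (fun s : Finset (basisIndex E) =>
      compress (fun l : s => (slice (onb E l) : F →L[ℂ] _)) B x) atTop (𝓝 (S x)) :=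
  exists_compress_tendsto (fun l => slice (onb E l)) hB hC0 hC

lemma IsTraceFst.hasSum_qform {B : HTensor E F →L[ℂ] HTensor E F} {S : F →L[ℂ] F}
    (h : IsTraceFst B S) (x : F) :
    HasSum (fun i => qform B (htmul (onb E i) x)) (qform S x) :=
  (h x x).mapL Complex.reCLM

lemma IsTraceFst.nonneg {B : HTensor E F →L[ℂ] HTensor E F} (hB : 0 ≤ B) {S : F →L[ℂ] F}
    (h : IsTraceFst B S) : 0 ≤ S := by
  rw [ContinuousLinearMap.nonneg_iff_isPositive]
  refine ⟨fun x y => ?_, fun x => ?_⟩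
  · have h3 := (h y x).map (starRingEnd ℂ) RCLike.continuous_conj
    simp only [Function.comp_def, inner_conj_symm] at h3
    simp only [inner_symm_of_nonneg hB] at h3
    exact h3.unique (h x y)
  · rw [ContinuousLinearMap.reApplyInnerSelf_apply, inner_re_symm]
    exact (h.hasSum_qform x).nonneg fun i => qform_nonneg hB _

lemma IsTraceFst.compress_le {B : HTensor E F →L[ℂ] HTensor E F} (hB : 0 ≤ B) {S : F →L[ℂ] F}
    (h : IsTraceFst B S) (s : Finset (basisIndex E)) :
    compress (fun l : s => (slice (onb E l) : F →L[ℂ] _)) B ≤ S := by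
  refine le_of_qform (compress_nonneg _ hB).isSelfAdjoint (h.nonneg hB).isSelfAdjoint fun x => ?_
  rw [qform_compress, Finset.sum_coe_sort s fun l => qform B (slice (onb E l) x)]
  exact sum_le_hasSum s (fun i _ => qform_nonneg hB _) (h.hasSum_qform x)

lemma IsTraceFst.trace_eq {B : HTensor E F →L[ℂ] HTensor E F} (hB : 0 ≤ B) {S : F →L[ℂ] F}
    (h : IsTraceFst B S) :
    trace S = ∑' q, ENNReal.ofReal (qform B (prodBasis (onb E) (onb F) q)) := by
  have e : ∀ m, ENNReal.ofReal (RCLike.re ⟪onb F m, S (onb F m)⟫_ℂ) =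
      ∑' l, ENNReal.ofReal (qform B (htmul (onb E l) (onb F m))) := by
    intro m
    rw [← ENNReal.ofReal_tsum_of_nonneg (fun l => qform_nonneg hB _)
      (h.hasSum_qform _).summable, (h.hasSum_qform _).tsum_eq]
    rfl
  simp only [trace, e, prodBasis_apply]
  rw [ENNReal.tsum_comm,
    ENNReal.tsum_prod (f := fun l m => ENNReal.ofReal (qform B (htmul (onb E l) (onb F m))))]

/-- For a unit vector `x` the vectors `onb E l ⊗ x` are orthonormal, so the full trace bounds every
truncation. -/
lemma exists_isTraceFst_of_tsum_le {B : HTensor E F →L[ℂ] HTensor E F} (hB : 0 ≤ B) {C : ℝ}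
    (hC0 : 0 ≤ C)
    (hC : ∑' q, ENNReal.ofReal (qform B (prodBasis (onb E) (onb F) q)) ≤ ENNReal.ofReal C) :
    ∃ S : F →L[ℂ] F, IsTraceFst B S := by
  obtain ⟨S, -, h, -⟩ := exists_isTraceFst hB hC0 fun s => qform_le_of_unit fun x hx => by
    have ho : Orthonormal ℂ fun l : basisIndex E => htmul (onb E l) x := by
      have hx' : Orthonormal ℂ (fun _ : Unit => x) := ⟨fun _ => hx, fun i j hij => (hij rfl).elim⟩
      exact (orthonormal_htmul (onb E).orthonormal hx').comp (fun l => (l, ()))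
        fun _ _ h => (Prod.ext_iff.1 h).1
    have h1 := (sum_qform_le_tsum hB ho s (prodBasis (onb E) (onb F))).trans hC
    rw [ENNReal.ofReal_le_ofReal_iff hC0] at h1
    rwa [qform_compress, Finset.sum_coe_sort s fun l => qform B (slice (onb E l) x)]
  exact ⟨S, h⟩

variable {T : HTensor E (HTensor F G) →L[ℂ] HTensor E (HTensor F G)}
  {X : HTensor E G →L[ℂ] HTensor E G}

/-- The definition tests elementary tensors only. Linearity reaches the algebraic tensor product,
which contains the finite combinations used below and is dense. -/
lemma IsTraceMid.hasSum_ofTensor (h : IsTraceMid T X) (u v : E ⊗[ℂ] G) :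
    HasSum (fun k => ⟪insertMid (onb F k) (ofTensor u), T (insertMid (onb F k) (ofTensor v))⟫_ℂ)
      ⟪ofTensor u, X (ofTensor v)⟫_ℂ := by
  induction u using TensorProduct.induction_on with
  | zero => simp
  | add u u' hu hu' =>
    simp only [map_add, inner_add_left]
    exact hu.add hu'
  | tmul x z =>
    induction v using TensorProduct.induction_on with
    | zero => simp
    | add v v' hv hv' =>
      simp only [map_add, inner_add_right]
      exact hv.add hv'
    | tmul x' z' =>
      have := h x x' z z'
      simp only [← insertMid_htmul] at this
      exact this

lemma IsTraceMid.nonneg (hT : 0 ≤ T) (h : IsTraceMid T X) : 0 ≤ X := by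
  rw [ContinuousLinearMap.nonneg_iff_isPositive]
  have hsym : ∀ x y, ⟪X x, y⟫_ℂ = ⟪x, X y⟫_ℂ := by
    intro x y
    refine denseRange_ofTensor.induction_on₂ (p := fun x y => ⟪X x, y⟫_ℂ = ⟪x, X y⟫_ℂ)
      ?_ (fun u v => ?_) x y
    · exact isClosed_eq (by fun_prop) (by fun_prop)
    · have h3 := (h.hasSum_ofTensor v u).map (starRingEnd ℂ) RCLike.continuous_conj
      simp only [Function.comp_def, inner_conj_symm] at h3
      simp only [inner_symm_of_nonneg hT] at h3
      exact h3.unique (h.hasSum_ofTensor u v)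
  refine ⟨hsym, fun x => ?_⟩
  rw [ContinuousLinearMap.reApplyInnerSelf_apply, inner_re_symm]
  refine denseRange_ofTensor.induction_on (p := fun x => 0 ≤ RCLike.re ⟪x, X x⟫_ℂ) x ?_
    fun u => ?_
  · exact isClosed_le (by fun_prop) (by fun_prop)
  · exact ((h.hasSum_ofTensor u u).mapL Complex.reCLM).nonneg fun k => qform_nonneg hT _

end PartialTrace

/-! ### Left side at most right side: finite truncations -/

section LeftLeRight

variable {H₁ H₂ H₃ : Type*}
  [NormedAddCommGroup H₁] [InnerProductSpace ℂ H₁] [CompleteSpace H₁]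
  [NormedAddCommGroup H₂] [InnerProductSpace ℂ H₂] [CompleteSpace H₂]
  [NormedAddCommGroup H₃] [InnerProductSpace ℂ H₃] [CompleteSpace H₃]

lemma comb_map {H K n : Type*} [NormedAddCommGroup H] [InnerProductSpace ℂ H]
    [CompleteSpace H] [NormedAddCommGroup K] [InnerProductSpace ℂ K] [CompleteSpace K] [Fintype n]
    [DecidableEq n] (T : H →L[ℂ] K) (U : Matrix n n ℂ) (f : n → H) (i : n) :
    T (comb U f i) = comb U (fun q => T (f q)) i := by
  simp [comb]

/-- The truncated partial trace over the first factor. -/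
def partialFst {E F : Type*} [NormedAddCommGroup E] [InnerProductSpace ℂ E] [CompleteSpace E]
    [NormedAddCommGroup F] [InnerProductSpace ℂ F] [CompleteSpace F] (s : Finset (basisIndex E))
    (B : HTensor E F →L[ℂ] HTensor E F) : F →L[ℂ] F :=
  compress (fun l : s => (slice (onb E l) : F →L[ℂ] HTensor E F)) B

section PartialFst

variable {E F : Type*} [NormedAddCommGroup E] [InnerProductSpace ℂ E] [CompleteSpace E]
    [NormedAddCommGroup F] [InnerProductSpace ℂ F] [CompleteSpace F]

lemma partialFst_nonneg (s : Finset (basisIndex E)) {B : HTensor E F →L[ℂ] HTensor E F}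
    (hB : 0 ≤ B) : 0 ≤ partialFst s B := compress_nonneg _ hB

lemma qform_partialFst (s : Finset (basisIndex E)) (B : HTensor E F →L[ℂ] HTensor E F) (x : F) :
    qform (partialFst s B) x = ∑ l ∈ s, qform B (htmul (onb E l) x) := by
  rw [partialFst, qform_compress]
  exact Finset.sum_coe_sort s fun l => qform B (slice (onb E l) x)

lemma tendsto_partialFst_apply {ι : Type*} {l : Filter ι} (s : Finset (basisIndex E))
    {B : ι → HTensor E F →L[ℂ] HTensor E F} {T : HTensor E F →L[ℂ] HTensor E F}
    (h : ∀ x, Tendsto (fun i => B i x) l (𝓝 (T x))) (x : F) :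
    Tendsto (fun i => partialFst s (B i) x) l (𝓝 (partialFst s T x)) := by
  simp only [partialFst, compress, sum_apply, ContinuousLinearMap.comp_apply]
  exact tendsto_finsetSum _ fun k _ =>
    ((ContinuousLinearMap.continuous _).tendsto _).comp (h _)

end PartialFst

/-- Weighted AM-GM for `w^(1-r) y` and `w`: the powers of `w` cancel since `(1 - r) θ + (1 - θ) =
0`. -/
lemma young_rpow {r θ y w : ℝ} (hr : 1 ≤ r) (hθ : θ = r⁻¹) (hy : 0 ≤ y) (hw : 0 < w) :
    y ^ θ ≤ θ * (w ^ (1 - r) * y) + (1 - θ) * w := by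
  have hr0 : 0 < r := by linarith
  have hθ0 : 0 ≤ θ := by rw [hθ]; positivity
  have hθ1 : θ ≤ 1 := by rw [hθ]; exact inv_le_one_of_one_le₀ hr
  have h := Real.geom_mean_le_arith_mean2_weighted hθ0 (sub_nonneg.2 hθ1)
    (p₁ := w ^ (1 - r) * y) (p₂ := w) (by positivity) hw.le (by ring)
  refine le_trans (le_of_eq ?_) h
  rw [Real.mul_rpow (by positivity) hy, ← Real.rpow_mul hw.le, mul_right_comm, ← Real.rpow_add hw]
  have : (1 - r) * θ + (1 - θ) = 0 := by rw [hθ]; field_simp; ring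
  rw [this, Real.rpow_zero, one_mul]

/-- The trace inequality for finite truncations, with regularized eigenvalues. -/
lemma sum_partialFst_rpow_le_add {r θ : ℝ} (hr : 1 ≤ r) (hr2 : r ≤ 2) (hθ : θ = r⁻¹)
    {B : HTensor H₁ (HTensor H₂ H₃) →L[ℂ] HTensor H₁ (HTensor H₂ H₃)} (hB : 0 ≤ B)
    {X : HTensor H₁ H₃ →L[ℂ] HTensor H₁ H₃} (hX : IsTraceMid (B ^ r) X)
    (s : Finset (basisIndex H₁)) (k : Finset (basisIndex H₂)) (t : Finset (basisIndex H₃))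
    [DecidableEq s] [DecidableEq t] [Nonempty s]
    {U : Matrix (s × t) (s × t) ℂ} (hU : U.conjTranspose * U = 1) (hU' : U * U.conjTranspose = 1)
    {ε : ℝ} (hε : 0 < ε) :
    ∑ m ∈ t, qform (partialFst k (partialFst s B ^ r) ^ θ) (onb H₃ m) ≤
      ∑ i, (qform X (comb U (fun q : s × t => htmul (onb H₁ q.1) (onb H₃ q.2)) i) + ε) ^ θ := by
  have hr0 : 0 < r := by linarith
  have hθ0 : 0 < θ := by rw [hθ]; positivity
  have hθ1 : θ ≤ 1 := by rw [hθ]; exact inv_le_one_of_one_le₀ hr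
  have hBr : 0 ≤ B ^ r := CFC.rpow_nonneg
  have hX0 : 0 ≤ X := hX.nonneg hBr
  set f : s × t → HTensor H₁ H₃ := fun q => htmul (onb H₁ q.1) (onb H₃ q.2) with hf
  set x : s × t → ℝ := fun i => qform X (comb U f i) with hx
  have hx0 : ∀ i, 0 ≤ x i := fun i => qform_nonneg hX0 _
  -- The optimal weight for the right side would be `x i ^ θ`; `ε` keeps it positive, and `ω^(1-r)
  -- (x + ε) = ω`.
  set ω : s × t → ℝ := fun i => (x i + ε) ^ θ with hω
  have hωpos : ∀ i, 0 < ω i := fun i => Real.rpow_pos_of_pos (by have := hx0 i; linarith) _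
  obtain ⟨V, ω', hV, hV', hc⟩ := exists_isCoupling hU hU' hωpos
  set Y := partialFst k (partialFst s B ^ r) with hY
  have hY0 : 0 ≤ Y := partialFst_nonneg _ CFC.rpow_nonneg
  let g : t → H₃ := comb V fun m : t => onb H₃ m
  have ho : Orthonormal ℂ (fun m : t => onb H₃ m) :=
    (onb H₃).orthonormal.comp _ Subtype.val_injective
  have hg : Orthonormal ℂ g := orthonormal_comb ho hV
  have h1 : ∑ m ∈ t, qform (Y ^ θ) (onb H₃ m) = ∑ j, qform (Y ^ θ) (g j) := by
    rw [sum_qform_comb _ _ hV', Finset.sum_coe_sort t fun m => qform (Y ^ θ) (onb H₃ m)]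
  -- `W` acts as the identity on `H₂`, so monotonicity applies separately to each basis vector of
  -- `H₂`.
  have h2 : ∀ k', ∑ j, ω' j ^ (1 - r) * qform (partialFst s B ^ r) (htmul (onb H₂ k') (g j)) ≤
      ∑ i, ω i ^ (1 - r) * qform (B ^ r) (insertMid (onb H₂ k') (comb U f i)) := by
    intro k'
    have := sum_rpow_le_of_one_le hc
      (a := fun l : s => (slice (onb H₁ l) : HTensor H₂ H₃ →L[ℂ] _)) inner_slice_onb hB
      (comb V fun m : t => htmul (onb H₂ k') (onb H₃ m)) hr hr2
    simp only [lift_couplingCoeff _ U hV'] at this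
    have e1 : ∀ j, htmul (onb H₂ k') (g j) =
        comb V (fun m : t => htmul (onb H₂ k') (onb H₃ m)) j := fun j =>
      comb_map (slice (onb H₂ k')) V _ j
    have e2 : ∀ i, insertMid (onb H₂ k') (comb U f i) =
        comb U (fun q : s × t => slice (onb H₁ q.1) (htmul (onb H₂ k') (onb H₃ q.2))) i := by
      intro i
      rw [comb_map]
      simp only [hf, insertMid_htmul, slice_apply]
    simp only [e1, e2]
    exact this
  have h3 : ∑ j, ω' j ^ (1 - r) * qform Y (g j) ≤ ∑ i, ω i := by
    calc ∑ j, ω' j ^ (1 - r) * qform Y (g j)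
        = ∑ k' ∈ k, ∑ j, ω' j ^ (1 - r) *
            qform (partialFst s B ^ r) (htmul (onb H₂ k') (g j)) := by
          rw [Finset.sum_comm]
          refine Finset.sum_congr rfl fun j _ => ?_
          rw [hY, qform_partialFst, Finset.mul_sum]
      _ ≤ ∑ k' ∈ k, ∑ i, ω i ^ (1 - r) *
            qform (B ^ r) (insertMid (onb H₂ k') (comb U f i)) := Finset.sum_le_sum fun k' _ => h2 k'
      _ = ∑ i, ω i ^ (1 - r) *
            ∑ k' ∈ k, qform (B ^ r) (insertMid (onb H₂ k') (comb U f i)) := by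
          rw [Finset.sum_comm]
          simp only [Finset.mul_sum]
      _ ≤ ∑ i, ω i := by
          refine Finset.sum_le_sum fun i _ => ?_
          have h4 : ∑ k' ∈ k, qform (B ^ r) (insertMid (onb H₂ k') (comb U f i)) ≤ x i := by
            have e : comb U f i = ofTensor
                (∑ q : s × t, U q i • ((onb H₁ q.1 : H₁) ⊗ₜ[ℂ] (onb H₃ q.2 : H₃))) := by
              rw [map_sum]
              simp only [map_smul]
              rfl
            have h5 := (hX.hasSum_ofTensor (∑ q : s × t, U q i • ((onb H₁ q.1 : H₁) ⊗ₜ[ℂ]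
              (onb H₃ q.2 : H₃))) (∑ q : s × t, U q i • ((onb H₁ q.1 : H₁) ⊗ₜ[ℂ]
              (onb H₃ q.2 : H₃)))).mapL Complex.reCLM
            rw [← e] at h5
            exact sum_le_hasSum k (fun _ _ => qform_nonneg hBr _) h5
          have h6 : ω i ^ (1 - r) * (x i + ε) = ω i := by
            have h7 : x i + ε = ω i ^ r := by
              rw [hω, ← Real.rpow_mul (by have := hx0 i; linarith), hθ, inv_mul_cancel₀ hr0.ne',
                Real.rpow_one]
            rw [h7, ← Real.rpow_add (hωpos i)]
            norm_num
          calc _ ≤ ω i ^ (1 - r) * (x i + ε) :=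
                mul_le_mul_of_nonneg_left (by linarith) (Real.rpow_nonneg (hωpos i).le _)
            _ = ω i := h6
  rw [h1]
  calc ∑ j, qform (Y ^ θ) (g j)
      ≤ ∑ j, (θ * (ω' j ^ (1 - r) * qform Y (g j)) + (1 - θ) * ω' j) :=
        Finset.sum_le_sum fun j _ => (qform_rpow_le hY0 (hg.1 j) hθ0 hθ1).trans
          (young_rpow hr hθ (qform_nonneg hY0 _) (hc.pos' j))
    _ = θ * ∑ j, ω' j ^ (1 - r) * qform Y (g j) + (1 - θ) * ∑ i, ω i := by
        rw [Finset.sum_add_distrib, ← Finset.mul_sum, ← Finset.mul_sum, hc.total]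
    _ ≤ θ * ∑ i, ω i + (1 - θ) * ∑ i, ω i := by gcongr
    _ = ∑ i, ω i := by ring

end LeftLeRight

/-! ### Left side at most right side: removing the truncations -/

section LeftLeRight

variable {H₁ H₂ H₃ : Type*}
  [NormedAddCommGroup H₁] [InnerProductSpace ℂ H₁] [CompleteSpace H₁]
  [NormedAddCommGroup H₂] [InnerProductSpace ℂ H₂] [CompleteSpace H₂]
  [NormedAddCommGroup H₃] [InnerProductSpace ℂ H₃] [CompleteSpace H₃]

lemma zero_rpow_op {H : Type*} [NormedAddCommGroup H] [InnerProductSpace ℂ H] [CompleteSpace H]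
    {s : ℝ} (hs : 0 < s) : (0 : H →L[ℂ] H) ^ s = 0 := by
  ext x
  have := rpow_apply_of_eigen (le_refl (0 : H →L[ℂ] H)) le_rfl (x := x) (by simp) hs.le
  simpa [Real.zero_rpow hs.ne'] using this

/-- The trace inequality for finite truncations. -/
lemma sum_partialFst_rpow_le {r θ : ℝ} (hr : 1 ≤ r) (hr2 : r ≤ 2) (hθ : θ = r⁻¹)
    {B : HTensor H₁ (HTensor H₂ H₃) →L[ℂ] HTensor H₁ (HTensor H₂ H₃)} (hB : 0 ≤ B)
    {X : HTensor H₁ H₃ →L[ℂ] HTensor H₁ H₃} (hX : IsTraceMid (B ^ r) X) {R : ℝ} (hR0 : 0 ≤ R)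
    (hR : ∑' q, ENNReal.ofReal (qform (X ^ θ) (prodBasis (onb H₁) (onb H₃) q)) ≤
      ENNReal.ofReal R)
    (s : Finset (basisIndex H₁)) (k : Finset (basisIndex H₂)) (t : Finset (basisIndex H₃)) :
    ∑ m ∈ t, qform (partialFst k (partialFst s B ^ r) ^ θ) (onb H₃ m) ≤ R := by
  classical
  have hr0 : 0 < r := by linarith
  have hθ0 : 0 < θ := by rw [hθ]; positivity
  have hX0 : 0 ≤ X := hX.nonneg CFC.rpow_nonneg
  -- Couplings exist only over a nonempty `s`; for empty `s` the sum vanishes.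
  rcases s.eq_empty_or_nonempty with rfl | hs
  · have h1 : partialFst (∅ : Finset (basisIndex H₁)) B = 0 := by
      simp [partialFst, compress]
    have h2 : partialFst k (0 : HTensor H₂ H₃ →L[ℂ] HTensor H₂ H₃) = 0 := by
      simp [partialFst, compress]
    rw [h1, zero_rpow_op hr0, h2, zero_rpow_op hθ0]
    simpa [qform] using hR0
  · have : Nonempty s := hs.to_subtype
    set f : s × t → HTensor H₁ H₃ := fun q => htmul (onb H₁ q.1) (onb H₃ q.2) with hf
    have ho₁ : Orthonormal ℂ (fun l : s => onb H₁ l) :=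
      (onb H₁).orthonormal.comp _ Subtype.val_injective
    have ho₃ : Orthonormal ℂ (fun m : t => onb H₃ m) :=
      (onb H₃).orthonormal.comp _ Subtype.val_injective
    have hfo : Orthonormal ℂ f := by
      have := orthonormal_htmul ho₁ ho₃
      exact this
    obtain ⟨U, x, hU, hU', hd⟩ := exists_diagonalization (gram_isHermitian hX0 f)
    have h1 := (sum_rpow_qform_le hX0 (orthonormal_comb hfo hU) (fun i i' hii => by
      rw [inner_comb, hd, Matrix.diagonal_apply_ne _ hii]) hθ0
      (prodBasis (onb H₁) (onb H₃))).trans hR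
    rw [ENNReal.ofReal_le_ofReal_iff hR0] at h1
    have h2 : Tendsto (fun ε : ℝ => ∑ i, (qform X (comb U f i) + ε) ^ θ) (𝓝[>] 0)
        (𝓝 (∑ i, (qform X (comb U f i) + 0) ^ θ)) := by
      refine Tendsto.mono_left (Continuous.tendsto ?_ 0) nhdsWithin_le_nhds
      exact continuous_finsetSum _ fun i _ =>
        (Real.continuous_rpow_const hθ0.le).comp (continuous_const.add continuous_id)
    simp only [add_zero] at h2
    refine le_trans (ge_of_tendsto h2 ?_) h1
    filter_upwards [self_mem_nhdsWithin] with ε hε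
    exact sum_partialFst_rpow_le_add hr hr2 hθ hB hX s k t hU hU' hε

lemma rpow_inv_rpow {H : Type*} [NormedAddCommGroup H] [InnerProductSpace ℂ H] [CompleteSpace H]
    {Y : H →L[ℂ] H} (hY : 0 ≤ Y) {r : ℝ} (hr : 0 < r) : (Y ^ r⁻¹) ^ r = Y := by
  rw [CFC.rpow_rpow_of_exponent_nonneg _ _ _ (inv_nonneg.2 hr.le) hr.le hY,
    inv_mul_cancel₀ hr.ne', CFC.rpow_one Y hY]

lemma rpow_le_smul {H : Type*} [NormedAddCommGroup H] [InnerProductSpace ℂ H] [CompleteSpace H]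
    {T : H →L[ℂ] H} (hT : 0 ≤ T) {R r : ℝ} (hR : ‖T‖ ≤ R) (hr : 1 ≤ r) :
    T ^ r ≤ R ^ (r - 1) • T := by
  have hcont : Continuous (fun x : ℝ => x ^ r) := Real.continuous_rpow_const (by linarith)
  rw [rpow_eq_cfc T hT, ← cfc_const_mul_id (R ^ (r - 1)) T]
  refine cfc_mono (fun y hy => ?_) hcont.continuousOn (by fun_prop)
  obtain ⟨h0, h1⟩ := spectrum_mem_Icc hT hR hy
  rcases h0.eq_or_lt with rfl | h0
  · rw [Real.zero_rpow (by linarith), mul_zero]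
  · calc y ^ r = y ^ (r - 1) * y := by rw [Real.rpow_sub_one h0.ne']; field_simp
      _ ≤ R ^ (r - 1) * y := by gcongr

/-- The trace bound gives `‖Y^(1/r)‖ ≤ R`, hence `Y ≤ R^(r-1) Y^(1/r)`. It turns control of the
trace of a root into the operator bounds needed for strong limits. -/
lemma tsum_qform_le_of_tsum_rpow_inv {H ι : Type*} [NormedAddCommGroup H] [InnerProductSpace ℂ H]
    [CompleteSpace H] {Y : H →L[ℂ] H} (hY : 0 ≤ Y) (b : HilbertBasis ι ℂ H) {r R : ℝ} (hr : 1 ≤ r)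
    (hR0 : 0 ≤ R) (hR : ∑' l, ENNReal.ofReal (qform (Y ^ r⁻¹) (b l)) ≤ ENNReal.ofReal R) :
    ∑' l, ENNReal.ofReal (qform Y (b l)) ≤ ENNReal.ofReal (R ^ r) := by
  have hT : 0 ≤ Y ^ r⁻¹ := CFC.rpow_nonneg
  have hn : ‖Y ^ r⁻¹‖ ≤ R := norm_le_of_qform hT hR0
    (qform_le_of_unit fun x hx => qform_le_of_tsum_le hT b hR0 hR hx)
  have h1 := rpow_le_smul hT hn hr
  rw [rpow_inv_rpow hY (by linarith)] at h1
  have e : R ^ r = R ^ (r - 1) * R := by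
    rcases hR0.eq_or_lt with rfl | h0
    · rw [Real.zero_rpow (by linarith), mul_zero]
    · rw [Real.rpow_sub_one h0.ne']; field_simp
  calc ∑' l, ENNReal.ofReal (qform Y (b l))
      ≤ ∑' l, ENNReal.ofReal (R ^ (r - 1)) * ENNReal.ofReal (qform (Y ^ r⁻¹) (b l)) := by
        refine ENNReal.tsum_le_tsum fun l => ?_
        rw [← ENNReal.ofReal_mul (by positivity), ← qform_smul]
        exact ENNReal.ofReal_le_ofReal (qform_mono h1 _)
    _ ≤ ENNReal.ofReal (R ^ r) := by
        rw [ENNReal.tsum_mul_left, e, ENNReal.ofReal_mul (by positivity)]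
        gcongr

lemma tsum_prodBasis_le {E F : Type*} [NormedAddCommGroup E] [InnerProductSpace ℂ E]
    [CompleteSpace E] [NormedAddCommGroup F] [InnerProductSpace ℂ F] [CompleteSpace F]
    {B : HTensor E F →L[ℂ] HTensor E F} (hB : 0 ≤ B) {C : ℝ}
    (h : ∀ (s : Finset (basisIndex E)) (t : Finset (basisIndex F)),
      ∑ m ∈ t, qform (partialFst s B) (onb F m) ≤ C) :
    ∑' q, ENNReal.ofReal (qform B (prodBasis (onb E) (onb F) q)) ≤ ENNReal.ofReal C := by
  classical
  refine tsum_ofReal_le (fun q => qform_nonneg hB _) fun u => ?_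
  refine le_trans ?_ (h (u.image Prod.fst) (u.image Prod.snd))
  simp only [qform_partialFst, prodBasis_apply]
  rw [← Finset.sum_product_right' (u.image Prod.fst) (u.image Prod.snd)
    fun l m => qform B (htmul (onb E l) (onb F m))]
  exact Finset.sum_le_sum_of_subset_of_nonneg Finset.subset_product fun q _ _ => qform_nonneg hB _

lemma exists_isTraceFst_of_partialFst {E F : Type*} [NormedAddCommGroup E] [InnerProductSpace ℂ E]
    [CompleteSpace E] [NormedAddCommGroup F] [InnerProductSpace ℂ F] [CompleteSpace F]
    {B : HTensor E F →L[ℂ] HTensor E F} (hB : 0 ≤ B) {C : ℝ} (hC0 : 0 ≤ C)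
    (hC : ∀ (s : Finset (basisIndex E)) (x : F), qform (partialFst s B) x ≤ C * ‖x‖ ^ 2) :
    ∃ S : F →L[ℂ] F, 0 ≤ S ∧ IsTraceFst B S ∧
      ∀ x, Tendsto (fun s => partialFst s B x) atTop (𝓝 (S x)) :=
  exists_isTraceFst hB hC0 hC

set_option maxHeartbeats 1000000 in
-- The truncation in `H₁` is removed first, then the one in `H₂`, and the one in `H₃` by the
-- definition of an infinite sum. Each strong limit uses a bound depending on `R` and `r` only.
theorem exists_left_le {r : ℝ} (hr : 1 ≤ r) (hr2 : r ≤ 2)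
    {B : HTensor H₁ (HTensor H₂ H₃) →L[ℂ] HTensor H₁ (HTensor H₂ H₃)} (hB : 0 ≤ B)
    {X : HTensor H₁ H₃ →L[ℂ] HTensor H₁ H₃} (hX : IsTraceMid (B ^ r) X) {R : ℝ} (hR0 : 0 ≤ R)
    (hR : ∑' q, ENNReal.ofReal (qform (X ^ r⁻¹) (prodBasis (onb H₁) (onb H₃) q)) ≤
      ENNReal.ofReal R) :
    ∃ (b : HTensor H₂ H₃ →L[ℂ] HTensor H₂ H₃) (Y : H₃ →L[ℂ] H₃), IsTraceFst B b ∧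
      IsTraceFst (b ^ r) Y ∧ trace (Y ^ r⁻¹) ≤ ENNReal.ofReal R := by
  have hr0 : 0 < r := by linarith
  have hRr : 0 ≤ R ^ r := by positivity
  have hfin := sum_partialFst_rpow_le hr hr2 rfl hB hX hR0 hR
  -- an operator whose power has trace at most `R` is bounded by `R ^ r`
  have hbound : ∀ Y : H₃ →L[ℂ] H₃, 0 ≤ Y →
      (∀ t, ∑ m ∈ t, qform (Y ^ r⁻¹) (onb H₃ m) ≤ R) →
      ∑' m, ENNReal.ofReal (qform Y (onb H₃ m)) ≤ ENNReal.ofReal (R ^ r) := fun Y hY h =>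
    tsum_qform_le_of_tsum_rpow_inv hY _ hr hR0
      (tsum_ofReal_le (fun _ => qform_nonneg CFC.rpow_nonneg _) h)
  have hqf : ∀ Y : H₃ →L[ℂ] H₃, 0 ≤ Y → (∀ t, ∑ m ∈ t, qform (Y ^ r⁻¹) (onb H₃ m) ≤ R) →
      ∀ x, qform Y x ≤ R ^ r * ‖x‖ ^ 2 := fun Y hY h =>
    qform_le_of_unit fun x hx => qform_le_of_tsum_le hY _ hRr (hbound Y hY h) hx
  have hs0 : ∀ s : Finset (basisIndex H₁), 0 ≤ partialFst s B := fun s => partialFst_nonneg s hB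
  have hsk0 : ∀ (s : Finset (basisIndex H₁)) (k : Finset (basisIndex H₂)),
      0 ≤ partialFst k (partialFst s B ^ r) := fun s k => partialFst_nonneg k CFC.rpow_nonneg
  have hs : ∀ (s : Finset (basisIndex H₁)) x, qform (partialFst s B) x ≤ R * ‖x‖ ^ 2 := by
    intro s
    refine qform_le_of_unit fun x hx => ?_
    have h1 : ∑' q, ENNReal.ofReal (qform (partialFst s B ^ r)
        (prodBasis (onb H₂) (onb H₃) q)) ≤ ENNReal.ofReal (R ^ r) :=
      tsum_prodBasis_le CFC.rpow_nonneg fun k =>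
        sum_le_of_tsum_ofReal_le (fun _ => qform_nonneg (hsk0 s k) _) hRr
          (hbound _ (hsk0 s k) (hfin s k))
    -- For a unit vector, the form to the power `r` is at most the form of the `r`-th power, hence
    -- at most the trace bound `R ^ r`.
    have h2 := (qform_rpow_ge (hs0 s) hx hr).trans
      (qform_le_of_tsum_le CFC.rpow_nonneg _ hRr h1 hx)
    exact (Real.rpow_le_rpow_iff (qform_nonneg (hs0 s) x) hR0 hr0).1 h2
  obtain ⟨b, hb0, hb, hbt⟩ := exists_isTraceFst_of_partialFst hB hR0 hs
  have hbr : ∀ x, Tendsto (fun s => (partialFst s B ^ r) x) atTop (𝓝 ((b ^ r) x)) :=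
    tendsto_rpow_apply hs0 hb0 (fun s => norm_le_of_qform (hs0 s) hR0 (hs s)) hbt hr0.le
  have hk0 : ∀ k : Finset (basisIndex H₂), 0 ≤ partialFst k (b ^ r) := fun k =>
    partialFst_nonneg k CFC.rpow_nonneg
  have hk : ∀ k t, ∑ m ∈ t, qform (partialFst k (b ^ r) ^ r⁻¹) (onb H₃ m) ≤ R := fun k t =>
    sum_qform_le_of_tendsto (tendsto_rpow_apply (fun s => hsk0 s k) (hk0 k)
      (fun s => norm_le_of_qform (hsk0 s k) hRr (hqf _ (hsk0 s k) (hfin s k)))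
      (tendsto_partialFst_apply k hbr) (inv_nonneg.2 hr0.le)) t
      (Eventually.of_forall fun s => hfin s k t)
  have hkq := fun k => hqf _ (hk0 k) (hk k)
  obtain ⟨Y, hY0, hY, hYt⟩ := exists_isTraceFst_of_partialFst (CFC.rpow_nonneg (a := b) (y := r)) hRr hkq
  refine ⟨b, Y, hb, hY, tsum_ofReal_le (fun m => qform_nonneg CFC.rpow_nonneg _) fun t => ?_⟩
  exact sum_qform_le_of_tendsto (tendsto_rpow_apply hk0 hY0
    (fun k => norm_le_of_qform (hk0 k) hRr (hkq k)) hYt (inv_nonneg.2 hr0.le)) t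
    (Eventually.of_forall fun k => hk k t)

end LeftLeRight

/-! ### Right side at most left side: finite truncations -/

section RightLeLeft

section FiniteRank

open Matrix

variable {H : Type*} [NormedAddCommGroup H] [InnerProductSpace ℂ H] [CompleteSpace H]

/-- The operator `∑ |f q⟩⟨f q|`. -/
def rankSum {ι : Type*} (u : Finset ι) (f : ι → H) : H →L[ℂ] H :=
  ∑ q ∈ u, (innerSL ℂ (f q)).smulRight (f q)

lemma rankSum_apply {ι : Type*} (u : Finset ι) (f : ι → H) (x : H) :
    rankSum u f x = ∑ q ∈ u, ⟪f q, x⟫_ℂ • f q := by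
  simp [rankSum]

lemma inner_rankSum {ι : Type*} (u : Finset ι) (f : ι → H) (x y : H) :
    ⟪rankSum u f x, y⟫_ℂ = ⟪x, rankSum u f y⟫_ℂ := by
  simp only [rankSum_apply, sum_inner, inner_sum, inner_smul_left, inner_smul_right,
    inner_conj_symm]
  exact Finset.sum_congr rfl fun q _ => mul_comm _ _

lemma adjoint_rankSum {ι : Type*} (u : Finset ι) (f : ι → H) :
    (rankSum u f).adjoint = rankSum u f := by
  symm
  rw [ContinuousLinearMap.eq_adjoint_iff]
  exact inner_rankSum u f

lemma rankSum_self {ι : Type*} {u : Finset ι} {f : ι → H} (hf : Orthonormal ℂ f) {q : ι}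
    (hq : q ∈ u) : rankSum u f (f q) = f q := by
  classical
  rw [rankSum_apply]
  simp only [orthonormal_iff_ite.1 hf, ite_smul, one_smul, zero_smul]
  rw [Finset.sum_ite_eq' , if_pos hq]

lemma norm_rankSum_le {ι : Type*} (u : Finset ι) {f : ι → H} (hf : Orthonormal ℂ f) :
    ‖rankSum u f‖ ≤ 1 := by
  refine ContinuousLinearMap.opNorm_le_bound _ zero_le_one fun x => ?_
  have h1 : rankSum u f (rankSum u f x) = rankSum u f x := by
    conv_lhs => rw [rankSum_apply u f x, map_sum]
    rw [rankSum_apply]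
    exact Finset.sum_congr rfl fun q hq => by rw [map_smul, rankSum_self hf hq]
  have h2 : ‖rankSum u f x‖ ^ 2 ≤ ‖x‖ * ‖rankSum u f x‖ := by
    calc ‖rankSum u f x‖ ^ 2 = ‖⟪rankSum u f x, rankSum u f x⟫_ℂ‖ := by
          rw [inner_self_eq_norm_sq_to_K]; simp
      _ = ‖⟪x, rankSum u f x⟫_ℂ‖ := by rw [inner_rankSum, h1]
      _ ≤ _ := norm_inner_le_norm _ _
  rw [one_mul]
  by_contra! h
  have := norm_nonneg x
  nlinarith

/-- The trace of a power of the compression of `X` to the span of an orthonormal family is the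
power sum of the eigenvalues of the matrix of `X`. -/
lemma sum_qform_compression_rpow {n : Type*} [Fintype n] [DecidableEq n] {X : H →L[ℂ] H}
    (hX : 0 ≤ X) {f : n → H} (hf : Orthonormal ℂ f) {U : Matrix n n ℂ} (hU : Uᴴ * U = 1)
    (hU' : U * Uᴴ = 1) {x : n → ℝ} (hd : Uᴴ * gram X f * U = diagonal fun i => (x i : ℂ))
    {σ : ℝ} (hσ : 0 ≤ σ) :
    ∑ q, qform (((rankSum Finset.univ f).adjoint ∘L X ∘L rankSum Finset.univ f) ^ σ) (f q) =
      ∑ i, qform X (comb U f i) ^ σ := by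
  have hT : 0 ≤ (rankSum Finset.univ f).adjoint ∘L X ∘L rankSum Finset.univ f :=
    adjoint_comp_nonneg _ hX
  have hx : ∀ i, x i = qform X (comb U f i) := by
    intro i
    have h1 : ⟪comb U f i, X (comb U f i)⟫_ℂ = x i := by
      rw [inner_comb, hd, diagonal_apply_eq]
    rw [qform, h1]; simp
  have hP : ∀ i, rankSum Finset.univ f (comb U f i) = comb U f i := by
    intro i
    rw [comb_map]
    simp only [rankSum_self hf (Finset.mem_univ _)]
  have hG : gram X f * U = U * diagonal fun i => (x i : ℂ) := by
    rw [← hd, Matrix.mul_assoc, ← Matrix.mul_assoc, hU', Matrix.one_mul]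
  have heig : ∀ i, ((rankSum Finset.univ f).adjoint ∘L X ∘L rankSum Finset.univ f) (comb U f i) =
      x i • comb U f i := by
    intro i
    rw [ContinuousLinearMap.comp_apply, ContinuousLinearMap.comp_apply, hP, adjoint_rankSum,
      rankSum_apply]
    have h1 : ∀ q, ⟪f q, X (comb U f i)⟫_ℂ = U q i * x i := by
      intro q
      have := congrFun (congrFun hG q) i
      rw [mul_diagonal, Matrix.mul_apply] at this
      rw [← this]
      simp only [comb, map_sum, map_smul, inner_sum, inner_smul_right, gram, of_apply]
      exact Finset.sum_congr rfl fun _ _ => mul_comm _ _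
    simp only [h1]
    simp only [comb, Finset.smul_sum, ← Complex.coe_smul, smul_smul]
    exact Finset.sum_congr rfl fun _ _ => by rw [mul_comm]
  rw [← sum_qform_comb _ f hU']
  refine Finset.sum_congr rfl fun i _ => ?_
  have hx0 : 0 ≤ x i := by rw [hx]; exact qform_nonneg hX _
  rw [qform, rpow_apply_of_eigen hT hx0 (heig i) hσ, ← Complex.coe_smul, inner_smul_right,
    inner_self_eq_norm_sq_to_K, (orthonormal_comb hf hU).1 i, ← hx]
  simp

end FiniteRank

/-- The truncated partial trace over the middle factor. -/
def partialMid {E F G : Type*} [NormedAddCommGroup E] [InnerProductSpace ℂ E] [CompleteSpace E]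
    [NormedAddCommGroup F] [InnerProductSpace ℂ F] [CompleteSpace F]
    [NormedAddCommGroup G] [InnerProductSpace ℂ G] [CompleteSpace G] (k : Finset (basisIndex F))
    (T : HTensor E (HTensor F G) →L[ℂ] HTensor E (HTensor F G)) : HTensor E G →L[ℂ] HTensor E G :=
  compress (fun l : k => (insertMid (onb F l) : HTensor E G →L[ℂ] HTensor E (HTensor F G))) T

section PartialMid

variable {E F G : Type*} [NormedAddCommGroup E] [InnerProductSpace ℂ E] [CompleteSpace E]
    [NormedAddCommGroup F] [InnerProductSpace ℂ F] [CompleteSpace F]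
    [NormedAddCommGroup G] [InnerProductSpace ℂ G] [CompleteSpace G]
    {T : HTensor E (HTensor F G) →L[ℂ] HTensor E (HTensor F G)}

lemma partialMid_nonneg (k : Finset (basisIndex F)) (hT : 0 ≤ T) : 0 ≤ partialMid k T :=
  compress_nonneg _ hT

lemma qform_partialMid (k : Finset (basisIndex F)) (x : HTensor E G) :
    qform (partialMid k T) x = ∑ l ∈ k, qform T (insertMid (onb F l) x) := by
  rw [partialMid, qform_compress]
  exact Finset.sum_coe_sort k fun l => qform T (insertMid (onb F l) x)

lemma exists_isTraceMid (hT : 0 ≤ T) {C : ℝ} (hC0 : 0 ≤ C)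
    (hC : ∀ (k : Finset (basisIndex F)) (x : HTensor E G),
      qform (partialMid k T) x ≤ C * ‖x‖ ^ 2) :
    ∃ S : HTensor E G →L[ℂ] HTensor E G, 0 ≤ S ∧ IsTraceMid T S ∧
      ∀ x, Tendsto (fun k => partialMid k T x) atTop (𝓝 (S x)) := by
  obtain ⟨S, hS, h, ht⟩ := exists_compress_tendsto
    (fun l => (insertMid (onb F l) : HTensor E G →L[ℂ] HTensor E (HTensor F G))) hT hC0 hC
  refine ⟨S, hS, fun x x' z z' => ?_, ht⟩
  have := h (htmul x z) (htmul x' z')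
  simpa only [insertMid_htmul] using this

end PartialMid

variable {H₁ H₂ H₃ : Type*}
  [NormedAddCommGroup H₁] [InnerProductSpace ℂ H₁] [CompleteSpace H₁]
  [NormedAddCommGroup H₂] [InnerProductSpace ℂ H₂] [CompleteSpace H₂]
  [NormedAddCommGroup H₃] [InnerProductSpace ℂ H₃] [CompleteSpace H₃]
  {B : HTensor H₁ (HTensor H₂ H₃) →L[ℂ] HTensor H₁ (HTensor H₂ H₃)}
  {b : HTensor H₂ H₃ →L[ℂ] HTensor H₂ H₃} {Y : H₃ →L[ℂ] H₃}

/-- Weighted AM-GM for `y^(1/r)` and `w` with weights `r` and `1 - r`. -/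
lemma mul_rpow_le_young {r y w : ℝ} (hr : 0 < r) (hr1 : r ≤ 1) (hy : 0 ≤ y) (hw : 0 ≤ w) :
    w ^ (1 - r) * y ≤ r * y ^ r⁻¹ + (1 - r) * w := by
  have h := Real.geom_mean_le_arith_mean2_weighted hr.le (sub_nonneg.2 hr1)
    (p₁ := y ^ r⁻¹) (p₂ := w) (by positivity) hw (by ring)
  rwa [← Real.rpow_mul hy, inv_mul_cancel₀ hr.ne', Real.rpow_one, mul_comm] at h

/-- The variational form of the trace inequality for finite truncations. -/
lemma sum_rpow_mul_qform_partialMid_le {r : ℝ} (hr : 0 < r) (hr1 : r ≤ 1) (hB : 0 ≤ B)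
    (hb : IsTraceFst B b) (hY : IsTraceFst (b ^ r) Y) {C : ℝ} (hC0 : 0 ≤ C)
    (hC : trace (Y ^ r⁻¹) ≤ ENNReal.ofReal C)
    (s : Finset (basisIndex H₁)) (k : Finset (basisIndex H₂)) (t : Finset (basisIndex H₃))
    [DecidableEq s] [DecidableEq t] [Nonempty s]
    {U : Matrix (s × t) (s × t) ℂ} (hU : U.conjTranspose * U = 1) (hU' : U * U.conjTranspose = 1)
    {ω : s × t → ℝ} (hω : ∀ i, 0 < ω i) :
    ∑ i, ω i ^ (1 - r) * qform (partialMid k (B ^ r))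
      (comb U (fun q : s × t => htmul (onb H₁ q.1) (onb H₃ q.2)) i) ≤
      r * C + (1 - r) * ∑ i, ω i := by
  set f : s × t → HTensor H₁ H₃ := fun q => htmul (onb H₁ q.1) (onb H₃ q.2) with hf
  obtain ⟨V, ω', hV, hV', hc⟩ := exists_isCoupling hU hU' hω
  have hbr : 0 ≤ b ^ r := CFC.rpow_nonneg
  have hY0 : 0 ≤ Y := hY.nonneg hbr
  let g : t → H₃ := comb V fun m : t => onb H₃ m
  have ho : Orthonormal ℂ (fun m : t => onb H₃ m) :=
    (onb H₃).orthonormal.comp _ Subtype.val_injective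
  have hg : Orthonormal ℂ g := orthonormal_comb ho hV
  -- Powers up to one are operator monotone, so the full partial trace `b` may replace its
  -- truncation.
  have hle : partialFst s B ^ r ≤ b ^ r := CFC.rpow_le_rpow ⟨hr.le, hr1⟩ (hb.compress_le hB s)
  have h2 : ∀ k', ∑ i, ω i ^ (1 - r) * qform (B ^ r) (insertMid (onb H₂ k') (comb U f i)) ≤
      ∑ j, ω' j ^ (1 - r) * qform (b ^ r) (htmul (onb H₂ k') (g j)) := by
    intro k'
    have := sum_rpow_le_of_le_one hc
      (a := fun l : s => (slice (onb H₁ l) : HTensor H₂ H₃ →L[ℂ] _)) inner_slice_onb hB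
      (comb V fun m : t => htmul (onb H₂ k') (onb H₃ m)) hr hr1
    simp only [lift_couplingCoeff _ U hV'] at this
    have e1 : ∀ j, htmul (onb H₂ k') (g j) =
        comb V (fun m : t => htmul (onb H₂ k') (onb H₃ m)) j := fun j =>
      comb_map (slice (onb H₂ k')) V _ j
    have e2 : ∀ i, insertMid (onb H₂ k') (comb U f i) =
        comb U (fun q : s × t => slice (onb H₁ q.1) (htmul (onb H₂ k') (onb H₃ q.2))) i := by
      intro i
      rw [comb_map]
      simp only [hf, insertMid_htmul, slice_apply]
    simp only [e1, e2]
    refine this.trans (Finset.sum_le_sum fun j _ => ?_)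
    exact mul_le_mul_of_nonneg_left (qform_mono hle _) (Real.rpow_nonneg (hc.pos' j).le _)
  have h3 : ∑ j, qform (Y ^ r⁻¹) (g j) ≤ C := by
    have := (sum_qform_le_tsum (CFC.rpow_nonneg (a := Y) (y := r⁻¹)) hg Finset.univ
      (onb H₃)).trans hC
    rwa [ENNReal.ofReal_le_ofReal_iff hC0] at this
  calc ∑ i, ω i ^ (1 - r) * qform (partialMid k (B ^ r)) (comb U f i)
      = ∑ k' ∈ k, ∑ i, ω i ^ (1 - r) *
          qform (B ^ r) (insertMid (onb H₂ k') (comb U f i)) := by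
        rw [Finset.sum_comm]
        simp only [qform_partialMid, Finset.mul_sum]
    _ ≤ ∑ k' ∈ k, ∑ j, ω' j ^ (1 - r) * qform (b ^ r) (htmul (onb H₂ k') (g j)) :=
        Finset.sum_le_sum fun k' _ => h2 k'
    _ = ∑ j, ω' j ^ (1 - r) * ∑ k' ∈ k, qform (b ^ r) (htmul (onb H₂ k') (g j)) := by
        rw [Finset.sum_comm]
        simp only [Finset.mul_sum]
    _ ≤ ∑ j, (r * qform (Y ^ r⁻¹) (g j) + (1 - r) * ω' j) := by
        refine Finset.sum_le_sum fun j _ => ?_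
        have h4 : ∑ k' ∈ k, qform (b ^ r) (htmul (onb H₂ k') (g j)) ≤ qform Y (g j) :=
          sum_le_hasSum k (fun _ _ => qform_nonneg hbr _) (hY.hasSum_qform (g j))
        have h5 := qform_rpow_ge hY0 (hg.1 j) (s := r⁻¹) ((one_le_inv₀ hr).2 hr1)
        calc _ ≤ ω' j ^ (1 - r) * qform Y (g j) :=
              mul_le_mul_of_nonneg_left h4 (Real.rpow_nonneg (hc.pos' j).le _)
          _ ≤ r * qform Y (g j) ^ r⁻¹ + (1 - r) * ω' j :=
              mul_rpow_le_young hr hr1 (qform_nonneg hY0 _) (hc.pos' j).le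
          _ ≤ _ := by gcongr
    _ = r * ∑ j, qform (Y ^ r⁻¹) (g j) + (1 - r) * ∑ i, ω i := by
        rw [Finset.sum_add_distrib, ← Finset.mul_sum, ← Finset.mul_sum, hc.total]
    _ ≤ r * C + (1 - r) * ∑ i, ω i := by gcongr

/-- Inserting the optimal weights `x i ^ r⁻¹`, regularized by `ε → 0` to stay positive, turns the
variational bound into the trace bound. -/
lemma sum_rpow_le_of_forall_weights {n : Type*} [Fintype n] {x : n → ℝ} (hx : ∀ i, 0 ≤ x i)
    {r C : ℝ} (hr : 0 < r) (hr1 : r ≤ 1)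
    (h : ∀ ω : n → ℝ, (∀ i, 0 < ω i) →
      ∑ i, ω i ^ (1 - r) * x i ≤ r * C + (1 - r) * ∑ i, ω i) : ∑ i, x i ^ r⁻¹ ≤ C := by
  have hσ : 0 < r⁻¹ := inv_pos.2 hr
  have hexp : 0 ≤ r⁻¹ * (1 - r) := mul_nonneg hσ.le (by linarith)
  have h1 : Tendsto (fun ε : ℝ => ∑ i, (x i + ε) ^ (r⁻¹ * (1 - r)) * x i) (𝓝[>] 0)
      (𝓝 (∑ i, (x i + 0) ^ (r⁻¹ * (1 - r)) * x i)) := by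
    refine Tendsto.mono_left (Continuous.tendsto ?_ 0) nhdsWithin_le_nhds
    exact continuous_finsetSum _ fun i _ =>
      ((Real.continuous_rpow_const hexp).comp (continuous_const.add continuous_id)).mul
        continuous_const
  have h2 : Tendsto (fun ε : ℝ => r * C + (1 - r) * ∑ i, (x i + ε) ^ r⁻¹) (𝓝[>] 0)
      (𝓝 (r * C + (1 - r) * ∑ i, (x i + 0) ^ r⁻¹)) := by
    refine Tendsto.mono_left (Continuous.tendsto ?_ 0) nhdsWithin_le_nhds
    exact continuous_const.add (continuous_const.mul (continuous_finsetSum _ fun i _ =>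
      (Real.continuous_rpow_const hσ.le).comp (continuous_const.add continuous_id)))
  have h3 := le_of_tendsto_of_tendsto h1 h2 (by
    filter_upwards [self_mem_nhdsWithin] with ε hε
    have hpos : ∀ i, 0 < x i + ε := fun i => add_pos_of_nonneg_of_pos (hx i) hε
    have := h (fun i => (x i + ε) ^ r⁻¹) fun i => Real.rpow_pos_of_pos (hpos i) _
    simpa only [← Real.rpow_mul (hpos _).le] using this)
  have e : ∀ i, (x i + 0) ^ (r⁻¹ * (1 - r)) * x i = x i ^ r⁻¹ := by
    intro i
    have h4 : r⁻¹ = r⁻¹ * (1 - r) + 1 := by field_simp; ring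
    conv_rhs => rw [h4, Real.rpow_add_of_nonneg (hx i) hexp zero_le_one, Real.rpow_one]
    rw [add_zero]
  simp only [e] at h3
  simp only [add_zero] at h3
  have : r * ∑ i, x i ^ r⁻¹ ≤ r * C := by linarith
  exact le_of_mul_le_mul_left this hr

end RightLeLeft

/-! ### Right side at most left side: removing the truncations -/

section RightLeLeftLimit

variable {H₁ H₂ H₃ : Type*}
  [NormedAddCommGroup H₁] [InnerProductSpace ℂ H₁] [CompleteSpace H₁]
  [NormedAddCommGroup H₂] [InnerProductSpace ℂ H₂] [CompleteSpace H₂]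
  [NormedAddCommGroup H₃] [InnerProductSpace ℂ H₃] [CompleteSpace H₃]
  {B : HTensor H₁ (HTensor H₂ H₃) →L[ℂ] HTensor H₁ (HTensor H₂ H₃)}
  {b : HTensor H₂ H₃ →L[ℂ] HTensor H₂ H₃} {Y : H₃ →L[ℂ] H₃}

/-- The projections tend strongly to the identity, so the compressions stay bounded by `‖X‖` and
tend strongly to `X`. -/
lemma tendsto_compression_rpow {H ι : Type*} [NormedAddCommGroup H] [InnerProductSpace ℂ H]
    [CompleteSpace H] {X : H →L[ℂ] H} (hX : 0 ≤ X) (e : HilbertBasis ι ℂ H) {σ : ℝ} (hσ : 0 ≤ σ)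
    (x : H) :
    Tendsto (fun u : Finset ι => (((rankSum u e).adjoint ∘L X ∘L rankSum u e) ^ σ) x) atTop
      (𝓝 ((X ^ σ) x)) := by
  have hP : ∀ y, Tendsto (fun u => rankSum u e y) atTop (𝓝 y) := by
    intro y
    simp only [rankSum_apply, ← HilbertBasis.repr_apply_apply]
    exact e.hasSum_repr y
  have hn : ∀ u : Finset ι, ‖rankSum u e‖ ≤ 1 := fun u => norm_rankSum_le u e.orthonormal
  refine tendsto_rpow_apply (C := ‖X‖) (fun u => adjoint_comp_nonneg _ hX) hX (fun u => ?_)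
    (fun y => ?_) hσ x
  · rw [adjoint_rankSum]
    calc _ ≤ ‖rankSum u e‖ * (‖X‖ * ‖rankSum u e‖) :=
          (ContinuousLinearMap.opNorm_comp_le _ _).trans
            (mul_le_mul_of_nonneg_left (ContinuousLinearMap.opNorm_comp_le _ _) (norm_nonneg _))
      _ ≤ 1 * (‖X‖ * 1) := by gcongr <;> exact hn u
      _ = ‖X‖ := by ring
  · simp only [adjoint_rankSum, ContinuousLinearMap.comp_apply]
    exact tendsto_clm_apply (S := 1) hn hP ((X.continuous.tendsto y).comp (hP y))

lemma sum_coe_product {ι κ M : Type*} [AddCommMonoid M] (s : Finset ι) (t : Finset κ)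
    (g : ι × κ → M) : ∑ q : s × t, g (q.1, q.2) = ∑ q ∈ s ×ˢ t, g q := by
  rw [Fintype.sum_prod_type, Finset.sum_product,
    Finset.sum_coe_sort s fun l => ∑ m : t, g (l, m)]
  exact Finset.sum_congr rfl fun l _ => Finset.sum_coe_sort t fun m => g (l, m)

set_option maxHeartbeats 1600000 in
-- The weights control the power of the compression of `X` to the span of `s × t`, not of `X`
-- itself; letting `s × t` grow recovers `X`.
lemma tsum_qform_partialMid_rpow_le {r : ℝ} (hr : 0 < r) (hr1 : r ≤ 1) (hB : 0 ≤ B)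
    (hb : IsTraceFst B b) (hY : IsTraceFst (b ^ r) Y) {C : ℝ} (hC0 : 0 ≤ C)
    (hC : trace (Y ^ r⁻¹) ≤ ENNReal.ofReal C) (k : Finset (basisIndex H₂)) :
    ∑' q, ENNReal.ofReal (qform (partialMid k (B ^ r) ^ r⁻¹) (prodBasis (onb H₁) (onb H₃) q)) ≤
      ENNReal.ofReal C := by
  classical
  have hσ : 0 ≤ r⁻¹ := inv_nonneg.2 hr.le
  set X := partialMid k (B ^ r) with hX
  have hX0 : 0 ≤ X := partialMid_nonneg k CFC.rpow_nonneg
  set e := prodBasis (onb H₁) (onb H₃) with he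
  refine tsum_ofReal_le (fun q => qform_nonneg CFC.rpow_nonneg _) fun u => ?_
  rcases u.eq_empty_or_nonempty with rfl | hu
  · simpa using hC0
  refine sum_qform_le_of_tendsto
    (fun x => (tendsto_compression_rpow hX0 e hσ x).comp tendsto_finsetProd_atTop) u ?_
  filter_upwards [tendsto_finsetProd_atTop.eventually_ge_atTop u] with ⟨s, t⟩ hst
  change u ⊆ s ×ˢ t at hst
  have hs : Nonempty s := by
    obtain ⟨q, hq⟩ := hu
    exact ⟨⟨q.1, (Finset.mem_product.1 (hst hq)).1⟩⟩
  set f : s × t → HTensor H₁ H₃ := fun q => htmul (onb H₁ q.1) (onb H₃ q.2) with hf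
  have hfe : ∀ q : s × t, f q = e (q.1, q.2) := fun q => by rw [he, prodBasis_apply]
  have hfo : Orthonormal ℂ f := by
    have := e.orthonormal.comp (fun q : s × t => ((q.1 : basisIndex H₁), (q.2 : basisIndex H₃)))
      fun q q' h => Prod.ext (Subtype.ext (Prod.ext_iff.1 h).1) (Subtype.ext (Prod.ext_iff.1 h).2)
    rwa [show f = _ from funext hfe]
  have hP : rankSum (s ×ˢ t) e = rankSum Finset.univ f := by
    rw [rankSum, rankSum, ← sum_coe_product]
    simp only [hfe]
  obtain ⟨U, x, hU, hU', hd⟩ := exists_diagonalization (gram_isHermitian hX0 f)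
  have h1 := sum_qform_compression_rpow hX0 hfo hU hU' hd hσ
  have h2 : ∑ i, qform X (comb U f i) ^ r⁻¹ ≤ C :=
    sum_rpow_le_of_forall_weights (fun i => qform_nonneg hX0 _) hr hr1 fun ω hω =>
      sum_rpow_mul_qform_partialMid_le hr hr1 hB hb hY hC0 hC s k t hU hU' hω
  simp only [hP]
  refine le_trans ?_ (h1.le.trans h2)
  simp only [hfe]
  rw [sum_coe_product s t fun q => qform
    (((rankSum Finset.univ f).adjoint ∘L X ∘L rankSum Finset.univ f) ^ r⁻¹) (e q)]
  exact Finset.sum_le_sum_of_subset_of_nonneg hst fun q _ _ => qform_nonneg CFC.rpow_nonneg _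

set_option maxHeartbeats 1600000 in
-- Jensen's inequality with exponent `1/r` bounds all truncations over `H₂` by `C ^ r`, so `X`
-- exists. The trace bound passes to `X ^ r⁻¹` and yields `Z`.
theorem exists_right_le {r : ℝ} (hr : 0 < r) (hr1 : r ≤ 1) (hB : 0 ≤ B)
    (hb : IsTraceFst B b) (hY : IsTraceFst (b ^ r) Y) {C : ℝ} (hC0 : 0 ≤ C)
    (hC : trace (Y ^ r⁻¹) ≤ ENNReal.ofReal C) :
    ∃ (X : HTensor H₁ H₃ →L[ℂ] HTensor H₁ H₃) (Z : H₃ →L[ℂ] H₃), IsTraceMid (B ^ r) X ∧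
      IsTraceFst (X ^ r⁻¹) Z ∧ trace Z ≤ ENNReal.ofReal C := by
  have hσ : 0 ≤ r⁻¹ := inv_nonneg.2 hr.le
  have hCr : 0 ≤ C ^ r := by positivity
  have hk0 : ∀ k : Finset (basisIndex H₂), 0 ≤ partialMid k (B ^ r) := fun k =>
    partialMid_nonneg k CFC.rpow_nonneg
  have hk := tsum_qform_partialMid_rpow_le hr hr1 hB hb hY hC0 hC
  have hq : ∀ (k : Finset (basisIndex H₂)) x,
      qform (partialMid k (B ^ r)) x ≤ C ^ r * ‖x‖ ^ 2 := by
    intro k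
    refine qform_le_of_unit fun x hx => ?_
    have h1 := (qform_rpow_ge (hk0 k) hx ((one_le_inv₀ hr).2 hr1)).trans
      (qform_le_of_tsum_le CFC.rpow_nonneg _ hC0 (hk k) hx)
    have h0 := qform_nonneg (hk0 k) x
    have h2 := Real.rpow_le_rpow (by positivity) h1 hr.le
    rwa [← Real.rpow_mul h0, inv_mul_cancel₀ hr.ne', Real.rpow_one] at h2
  obtain ⟨X, hX0, hX, hXt⟩ := exists_isTraceMid (CFC.rpow_nonneg (a := B) (y := r)) hCr hq
  have hXσ : 0 ≤ X ^ r⁻¹ := CFC.rpow_nonneg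
  have ht : ∑' q, ENNReal.ofReal (qform (X ^ r⁻¹) (prodBasis (onb H₁) (onb H₃) q)) ≤
      ENNReal.ofReal C :=
    tsum_ofReal_le (fun q => qform_nonneg hXσ _) fun u =>
      sum_qform_le_of_tendsto (tendsto_rpow_apply hk0 hX0
        (fun k => norm_le_of_qform (hk0 k) hCr (hq k)) hXt hσ) u
        (Eventually.of_forall fun k => sum_le_of_tsum_ofReal_le
          (fun _ => qform_nonneg CFC.rpow_nonneg _) hC0 (hk k) u)
  obtain ⟨Z, hZ⟩ := exists_isTraceFst_of_tsum_le hXσ hC0 ht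
  exact ⟨X, Z, hX, hZ, (hZ.trace_eq hXσ).trans_le ht⟩

end RightLeLeftLimit
end TraceMinkowski

end

/-! ### The theorem, by the substitution `B = A ^ q`, `r = p / q` -/

theorem theorem1p2 {H₁ H₂ H₃ : Type*}
    [NormedAddCommGroup H₁] [InnerProductSpace ℂ H₁] [CompleteSpace H₁]
    [TopologicalSpace.SeparableSpace H₁]
    [NormedAddCommGroup H₂] [InnerProductSpace ℂ H₂] [CompleteSpace H₂]
    [TopologicalSpace.SeparableSpace H₂]
    [NormedAddCommGroup H₃] [InnerProductSpace ℂ H₃] [CompleteSpace H₃]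
    [TopologicalSpace.SeparableSpace H₃]
    (A : TraceMinkowski.HTensor H₁ (TraceMinkowski.HTensor H₂ H₃) →L[ℂ]
      TraceMinkowski.HTensor H₁ (TraceMinkowski.HTensor H₂ H₃))
    (hA : A.IsPositive) (p q : ℝ) :
    (1 ≤ q → q ≤ p → p ≤ 2 →
      TraceMinkowski.leftSide p q A ≤ TraceMinkowski.rightSide p q A) ∧
    (0 < p → p ≤ 1 → p ≤ q →
      TraceMinkowski.rightSide p q A ≤ TraceMinkowski.leftSide p q A) := by
  have hA0 : 0 ≤ A := (ContinuousLinearMap.nonneg_iff_isPositive A).2 hA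
  have hAq : 0 ≤ A ^ q := CFC.rpow_nonneg
  have hpow : 0 < p → 0 < q → A ^ p = (A ^ q) ^ (p / q) := fun hp hq => by
    rw [CFC.rpow_rpow_of_exponent_nonneg _ _ _ hq.le (div_nonneg hp.le hq.le) hA0,
      mul_div_cancel₀ _ hq.ne']
  have hinv : q / p = (p / q)⁻¹ := (inv_div p q).symm
  refine ⟨fun hq hqp hp => ?_, fun hp _ hpq => ?_⟩
  · have hq0 : 0 < q := by linarith
    refine le_iInf fun X => le_iInf fun hX => le_iInf fun Z => le_iInf fun hZ => ?_
    -- An infinite larger side leaves nothing to prove; a finite one supplies the real constant `R`.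
    rcases eq_or_ne (TraceMinkowski.trace Z) ⊤ with htop | htop
    · rw [htop]; exact le_top
    rw [hpow (by linarith) hq0] at hX
    rw [hinv] at hZ
    obtain ⟨b, Y, hb, hY, h⟩ := TraceMinkowski.exists_left_le ((one_le_div hq0).2 hqp)
      ((div_le_iff₀ hq0).2 (by linarith)) hAq hX ENNReal.toReal_nonneg
      ((hZ.trace_eq CFC.rpow_nonneg).symm.trans (ENNReal.ofReal_toReal htop).symm).le
    rw [ENNReal.ofReal_toReal htop, ← hinv] at h
    exact iInf_le_of_le b <| iInf_le_of_le hb <| iInf_le_of_le Y <| iInf_le_of_le hY h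
  · have hq0 : 0 < q := by linarith
    refine le_iInf fun b => le_iInf fun hb => le_iInf fun Y => le_iInf fun hY => ?_
    rcases eq_or_ne (TraceMinkowski.trace (Y ^ (q / p))) ⊤ with htop | htop
    · rw [htop]; exact le_top
    have hC : TraceMinkowski.trace (Y ^ (p / q)⁻¹) ≤
        ENNReal.ofReal (TraceMinkowski.trace (Y ^ (q / p))).toReal := by
      rw [ENNReal.ofReal_toReal htop, hinv]
    obtain ⟨X, Z, hX, hZ, h⟩ := TraceMinkowski.exists_right_le (div_pos hp hq0)
      ((div_le_one hq0).2 hpq) hAq hb hY ENNReal.toReal_nonneg hC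
    rw [ENNReal.ofReal_toReal htop] at h
    rw [← hpow hp hq0] at hX
    rw [← hinv] at hZ
    exact iInf_le_of_le X <| iInf_le_of_le hX <| iInf_le_of_le Z <| iInf_le_of_le hZ h
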